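/- Let $V=\mathbb C^4$ and let $I=\{(x,\xi)\in\mathbb P^3\times(\mathbb P^3)^\vee : \sum_{k=0}^3 x_k\xi_k=0\}$ be the incidence variety of points and planes in $\mathbb P^3=\mathbb P(V)$, with its two projections $p_1\colon I\to\mathbb P^3$ and $p_2\colon I\to(\mathbb P^3)^\vee$. Put $H_1=p_1^*\mathcal O_{\mathbb P^3}(1)$ and $H_2=p_2^*\mathcal O_{(\mathbb P^3)^\vee}(1)$ in $\operatorname{Pic}(I)$. Let $Y$ be a scheme over $\mathbb C$, let $\Gamma\subset Y$ be a closed subscheme, let $\pi\colon Bl_\Gamma Y\to Y$ be the blow-up of $Y$ along $\Gamma$, and suppose that the exceptional divisor $\overline\Gamma=\pi^{-1}(\Gamma)$ is a disjoint union of copies $I_i$ of $I$, with fixed identifications $I_i\cong I$ over $\mathbb C$. (For instance, $Y$ is the double cover of the singular O'Grady moduli space $K_v(A,\theta)$ ramified along its singular locus and $\Gamma$ is the singular locus of $Y$, which consists of $256$ points with $\pi^{-1}(p_i)=I_i$.) Let $f$ be an automorphism of $Bl_\Gamma Y$ over $\mathbb C$ that leaves the exceptional divisor invariant, $f(\overline\Gamma)=\overline\Gamma$.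 Then $\operatorname{Pic}(I)=\langle H_1,H_2\rangle$ is free with basis $H_1,H_2$, and for every $i$ there is a $j$ such that $f$ maps $I_i$ isomorphically onto $I_j$; and if $f^*\colon\operatorname{Pic}(I)\to\operatorname{Pic}(I)$ denotes the action of the automorphism of $I$ which $f|_{I_i}\colon I_i\to I_j$ induces through the identifications, then either $f^*$ is the identity, or $f^*(H_1)=H_2$ and $f^*(H_2)=H_1$. -/

import Mathlib

open CategoryTheory CategoryTheory.Limits AlgebraicGeometry TopologicalSpace

namespace IncidenceBlowup

noncomputable section

universe u

/-! ### Line bundles through transition functions, and the Picard group -/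

/-- Restriction of functions. -/
abbrev resFun {X : Scheme.{u}} {U V : X.Opens} (h : V ≤ U) : Γ(X, U) →+* Γ(X, V) :=
  (X.presheaf.map (homOfLE h).op).hom

/-- Restriction of invertible functions. -/
def res {X : Scheme.{u}} {U V : X.Opens} (h : V ≤ U) : Γ(X, U)ˣ →* Γ(X, V)ˣ :=
  Units.map (resFun h)

/-- Pull-back of invertible functions along a morphism of schemes. -/
def pullUnit {X Y : Scheme.{u}} (f : X ⟶ Y) {U : Y.Opens} {V : X.Opens} (h : V ≤ f ⁻¹ᵁ U) :
    Γ(Y, U)ˣ →* Γ(X, V)ˣ :=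
  Units.map (f.appLE U V h).hom

lemma res_res {X : Scheme.{u}} {U V W : X.Opens} (h : V ≤ U) (h' : W ≤ V) (a : Γ(X, U)ˣ) :
    res h' (res h a) = res (h'.trans h) a := by
  ext
  simp only [res, Units.coe_map, MonoidHom.coe_coe, ← CommRingCat.comp_apply, ← Functor.map_comp]
  rfl

lemma res_pullUnit {X Y : Scheme.{u}} (f : X ⟶ Y) {U : Y.Opens} {V W : X.Opens}
    (h : V ≤ f ⁻¹ᵁ U) (h' : W ≤ V) (a : Γ(Y, U)ˣ) :
    res h' (pullUnit f h a) = pullUnit f (h'.trans h) a := by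
  ext
  simp only [res, pullUnit, Units.coe_map, MonoidHom.coe_coe, ← CommRingCat.comp_apply,
    Scheme.Hom.appLE_map]

lemma preimage_le {X Y : Scheme.{u}} (f : X ⟶ Y) {U U' : Y.Opens} {V : X.Opens}
    (h : V ≤ f ⁻¹ᵁ U) (h' : U ≤ U') : V ≤ f ⁻¹ᵁ U' :=
  fun _ hx => h' (h hx)

lemma pullUnit_res {X Y : Scheme.{u}} (f : X ⟶ Y) {U U' : Y.Opens} {V : X.Opens}
    (h : V ≤ f ⁻¹ᵁ U) (h' : U ≤ U') (a : Γ(Y, U')ˣ) :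
    pullUnit f h (res h' a) = pullUnit f (preimage_le f h h') a := by
  ext
  simp only [res, pullUnit, Units.coe_map, MonoidHom.coe_coe, ← CommRingCat.comp_apply,
    Scheme.Hom.map_appLE]

lemma le_preimage_inf {X Y : Scheme.{u}} (f : X ⟶ Y) {U U' : Y.Opens} {V : X.Opens}
    (h : V ≤ f ⁻¹ᵁ U) (h' : V ≤ f ⁻¹ᵁ U') : V ≤ f ⁻¹ᵁ (U ⊓ U') :=
  fun _ hx => ⟨h hx, h' hx⟩

/-- A line bundle on `X`, given by an open cover `U i` and transition functions
`g i j ∈ 𝒪(U i ∩ U j)ˣ` satisfying the cocycle condition. Sections are families `s i ∈ 𝒪(U i)`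
with `s i = g i j * s j` on `U i ∩ U j`. -/
structure LineBundle (X : Scheme.{u}) where
  ι : Type u
  U : ι → X.Opens
  cover : ∀ x : X, ∃ i, x ∈ U i
  g : ∀ i j, Γ(X, U i ⊓ U j)ˣ
  cocycle : ∀ i j k,
    res (V := U i ⊓ U j ⊓ U k) inf_le_left (g i j) *
      res (V := U i ⊓ U j ⊓ U k) (inf_le_inf_right _ inf_le_right) (g j k) =
    res (V := U i ⊓ U j ⊓ U k) (inf_le_inf_right _ inf_le_left) (g i k)

namespace LineBundle

variable {X Y Z : Scheme.{u}}

/-- The transition function `g i j`, restricted to an open set `V`. -/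
def tr (L : LineBundle X) (i j : L.ι) (V : X.Opens) (hi : V ≤ L.U i) (hj : V ≤ L.U j) :
    Γ(X, V)ˣ :=
  res (le_inf hi hj) (L.g i j)

lemma res_tr (L : LineBundle X) (i j : L.ι) {V W : X.Opens} (hi : V ≤ L.U i) (hj : V ≤ L.U j)
    (h : W ≤ V) : res h (L.tr i j V hi hj) = L.tr i j W (h.trans hi) (h.trans hj) :=
  res_res _ _ _

lemma tr_mul (L : LineBundle X) (i j k : L.ι) (V : X.Opens) (hi : V ≤ L.U i) (hj : V ≤ L.U j)
    (hk : V ≤ L.U k) : L.tr i j V hi hj * L.tr j k V hj hk = L.tr i k V hi hk := by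
  have := congrArg (res (le_inf (le_inf hi hj) hk)) (L.cocycle i j k)
  simpa only [map_mul, res_res] using! this

lemma tr_self (L : LineBundle X) (i : L.ι) (V : X.Opens) (hi : V ≤ L.U i) :
    L.tr i i V hi hi = 1 := by
  have := L.tr_mul i i i V hi hi hi
  simpa using this

/-- Isomorphism of line bundles: on some common refinement `W k` of the two covers the transition
functions differ by the coboundary of a family of invertible functions `t k`. -/
def Iso (L M : LineBundle X) : Prop :=
  ∃ (κ : Type u) (W : κ → X.Opens) (ρ : κ → L.ι) (σ : κ → M.ι)
    (hρ : ∀ k, W k ≤ L.U (ρ k)) (hσ : ∀ k, W k ≤ M.U (σ k)) (t : ∀ k, Γ(X, W k)ˣ),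
    (∀ x : X, ∃ k, x ∈ W k) ∧
    ∀ k l,
      L.tr (ρ k) (ρ l) (W k ⊓ W l) (inf_le_left.trans (hρ k)) (inf_le_right.trans (hρ l)) *
          res inf_le_right (t l) =
        res inf_le_left (t k) *
          M.tr (σ k) (σ l) (W k ⊓ W l) (inf_le_left.trans (hσ k)) (inf_le_right.trans (hσ l))

/-- Line bundles whose transition functions agree on a common refinement are isomorphic. -/
lemma Iso.of_eq {L M : LineBundle X} {κ : Type u} (W : κ → X.Opens) (ρ : κ → L.ι) (σ : κ → M.ι)
    (hρ : ∀ k, W k ≤ L.U (ρ k)) (hσ : ∀ k, W k ≤ M.U (σ k)) (hW : ∀ x : X, ∃ k, x ∈ W k)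
    (h : ∀ k l, L.tr (ρ k) (ρ l) (W k ⊓ W l)
        (inf_le_left.trans (hρ k)) (inf_le_right.trans (hρ l)) =
      M.tr (σ k) (σ l) (W k ⊓ W l) (inf_le_left.trans (hσ k)) (inf_le_right.trans (hσ l))) :
    L.Iso M :=
  ⟨κ, W, ρ, σ, hρ, hσ, fun _ => 1, hW, fun k l => by simp [h]⟩

lemma Iso.refl (L : LineBundle X) : L.Iso L :=
  .of_eq L.U id id (fun _ => le_rfl) (fun _ => le_rfl) L.cover fun _ _ => rfl

lemma Iso.symm {L M : LineBundle X} : L.Iso M → M.Iso L := by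
  rintro ⟨κ, W, ρ, σ, hρ, hσ, t, hW, h⟩
  refine ⟨κ, W, σ, ρ, hσ, hρ, fun k => (t k)⁻¹, hW, fun k l => ?_⟩
  rw [map_inv, map_inv, mul_inv_eq_iff_eq_mul, mul_assoc, eq_inv_mul_iff_mul_eq]
  exact (h k l).symm

lemma Iso.trans {L M N : LineBundle X} : L.Iso M → M.Iso N → L.Iso N := by
  rintro ⟨κ, W, ρ, σ, hρ, hσ, t, hW, h⟩ ⟨κ', W', ρ', σ', hρ', hσ', t', hW', h'⟩
  refine ⟨κ × κ', fun p => W p.1 ⊓ W' p.2, fun p => ρ p.1, fun p => σ' p.2,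
    fun p => inf_le_left.trans (hρ p.1), fun p => inf_le_right.trans (hσ' p.2),
    fun p => res inf_le_left (t p.1) *
      M.tr (σ p.1) (ρ' p.2) _ (inf_le_left.trans (hσ p.1)) (inf_le_right.trans (hρ' p.2)) *
      res inf_le_right (t' p.2), ?_, ?_⟩
  · intro x
    obtain ⟨k, hk⟩ := hW x
    obtain ⟨l, hl⟩ := hW' x
    exact ⟨(k, l), hk, hl⟩
  · rintro ⟨k, l⟩ ⟨m, n⟩
    dsimp only
    have e := congrArg (res (V := (W k ⊓ W' l) ⊓ (W m ⊓ W' n))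
      (inf_le_inf inf_le_left inf_le_left)) (h k m)
    have e' := congrArg (res (V := (W k ⊓ W' l) ⊓ (W m ⊓ W' n))
      (inf_le_inf inf_le_right inf_le_right)) (h' l n)
    simp only [map_mul, res_res, res_tr] at e e' ⊢
    rw [← mul_assoc, ← mul_assoc, e]
    rw [mul_assoc _ (M.tr _ _ _ _ _) (M.tr _ _ _ _ _), M.tr_mul, mul_assoc, mul_assoc, mul_assoc,
      ← e', ← mul_assoc (M.tr _ _ _ _ _) (M.tr _ _ _ _ _), M.tr_mul]

instance setoid (X : Scheme.{u}) : Setoid (LineBundle X) where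
  r := Iso
  iseqv := ⟨Iso.refl, Iso.symm, Iso.trans⟩

/-- The trivial line bundle. -/
abbrev trivial (X : Scheme.{u}) : LineBundle X where
  ι := PUnit
  U _ := ⊤
  cover x := ⟨⟨⟩, Opens.mem_top x⟩
  g _ _ := 1
  cocycle _ _ _ := by simp

/-- The tensor product of two line bundles. -/
abbrev tensor (L M : LineBundle X) : LineBundle X where
  ι := L.ι × M.ι
  U p := L.U p.1 ⊓ M.U p.2
  cover x := by
    obtain ⟨i, hi⟩ := L.cover x
    obtain ⟨j, hj⟩ := M.cover x
    exact ⟨(i, j), hi, hj⟩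
  g p q :=
    L.tr p.1 q.1 _ (inf_le_left.trans inf_le_left) (inf_le_right.trans inf_le_left) *
      M.tr p.2 q.2 _ (inf_le_left.trans inf_le_right) (inf_le_right.trans inf_le_right)
  cocycle p q r := by
    simp only [map_mul, res_tr]
    rw [mul_mul_mul_comm, L.tr_mul, M.tr_mul]

/-- The dual line bundle. -/
abbrev dual (L : LineBundle X) : LineBundle X where
  ι := L.ι
  U := L.U
  cover := L.cover
  g i j := (L.g i j)⁻¹
  cocycle i j k := by
    rw [map_inv, map_inv, map_inv, ← mul_inv, L.cocycle]

/-- The pull-back of a line bundle along a morphism. -/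
abbrev pullback (f : X ⟶ Y) (L : LineBundle Y) : LineBundle X where
  ι := L.ι
  U i := f ⁻¹ᵁ L.U i
  cover x := L.cover (f x)
  g i j := pullUnit f (le_preimage_inf f inf_le_left inf_le_right) (L.g i j)
  cocycle i j k := by
    have := congrArg (pullUnit f (V := f ⁻¹ᵁ L.U i ⊓ f ⁻¹ᵁ L.U j ⊓ f ⁻¹ᵁ L.U k)
      (le_preimage_inf f (le_preimage_inf f (inf_le_left.trans inf_le_left)
        (inf_le_left.trans inf_le_right)) inf_le_right)) (L.cocycle i j k)
    simpa only [map_mul, res_pullUnit, pullUnit_res] using! this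

lemma tensor_tr (L M : LineBundle X) (p q : L.ι × M.ι) (V : X.Opens)
    (hp : V ≤ L.U p.1 ⊓ M.U p.2) (hq : V ≤ L.U q.1 ⊓ M.U q.2) :
    (L.tensor M).tr p q V hp hq =
      L.tr p.1 q.1 V (hp.trans inf_le_left) (hq.trans inf_le_left) *
        M.tr p.2 q.2 V (hp.trans inf_le_right) (hq.trans inf_le_right) := by
  simp only [tr, tensor, map_mul, res_res]

lemma trivial_tr (p q : PUnit) (V : X.Opens) (hp hq) : (trivial X).tr p q V hp hq = 1 := by
  simp [tr, trivial]

lemma dual_tr (L : LineBundle X) (i j : L.ι) (V : X.Opens) (hi : V ≤ L.U i) (hj : V ≤ L.U j) :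
    L.dual.tr i j V hi hj = (L.tr i j V hi hj)⁻¹ := by
  simp [tr, dual]

lemma pullback_tr (f : X ⟶ Y) (L : LineBundle Y) (i j : L.ι) (V : X.Opens)
    (hi : V ≤ f ⁻¹ᵁ L.U i) (hj : V ≤ f ⁻¹ᵁ L.U j) :
    (L.pullback f).tr i j V hi hj =
      pullUnit f (le_preimage_inf f hi hj) (L.g i j) :=
  res_pullUnit _ _ _ _

lemma Iso.tensor {L L' M M' : LineBundle X} :
    L.Iso L' → M.Iso M' → (L.tensor M).Iso (L'.tensor M') := by
  rintro ⟨κ, W, ρ, σ, hρ, hσ, t, hW, h⟩ ⟨κ', W', ρ', σ', hρ', hσ', t', hW', h'⟩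
  refine ⟨κ × κ', fun p => W p.1 ⊓ W' p.2, fun p => (ρ p.1, ρ' p.2), fun p => (σ p.1, σ' p.2),
    fun p => inf_le_inf (hρ _) (hρ' _), fun p => inf_le_inf (hσ _) (hσ' _),
    fun p => res inf_le_left (t p.1) * res inf_le_right (t' p.2), ?_, ?_⟩
  · intro x
    obtain ⟨k, hk⟩ := hW x
    obtain ⟨l, hl⟩ := hW' x
    exact ⟨(k, l), hk, hl⟩
  · rintro ⟨k, l⟩ ⟨m, n⟩
    have e := congrArg (res (V := (W k ⊓ W' l) ⊓ (W m ⊓ W' n))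
      (inf_le_inf inf_le_left inf_le_left)) (h k m)
    have e' := congrArg (res (V := (W k ⊓ W' l) ⊓ (W m ⊓ W' n))
      (inf_le_inf inf_le_right inf_le_right)) (h' l n)
    simp only [map_mul, res_res, res_tr, tensor_tr] at e e' ⊢
    rw [mul_mul_mul_comm, e, e', mul_mul_mul_comm]

lemma Iso.dual {L M : LineBundle X} : L.Iso M → L.dual.Iso M.dual := by
  rintro ⟨κ, W, ρ, σ, hρ, hσ, t, hW, h⟩
  refine ⟨κ, W, ρ, σ, hρ, hσ, fun k => (t k)⁻¹, hW, fun k l => ?_⟩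
  rw [dual_tr, dual_tr, map_inv, map_inv, ← mul_inv, ← mul_inv]
  exact congrArg _ (h k l)

lemma Iso.pullback (f : X ⟶ Y) {L M : LineBundle Y} :
    L.Iso M → (L.pullback f).Iso (M.pullback f) := by
  rintro ⟨κ, W, ρ, σ, hρ, hσ, t, hW, h⟩
  refine ⟨κ, fun k => f ⁻¹ᵁ W k, ρ, σ, fun k _ hx => hρ k hx, fun k _ hx => hσ k hx,
    fun k => pullUnit f le_rfl (t k), fun x => hW (f x), fun k l => ?_⟩
  have e := congrArg (pullUnit f (V := f ⁻¹ᵁ W k ⊓ f ⁻¹ᵁ W l)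
    (le_preimage_inf f inf_le_left inf_le_right)) (h k l)
  simp only [map_mul, tr, pullUnit_res] at e
  rw [pullback_tr, pullback_tr, res_pullUnit, res_pullUnit]
  exact e

end LineBundle

/-- The Picard group of a scheme: line bundles up to isomorphism. -/
def Pic (X : Scheme.{u}) : Type (u + 1) := Quotient (LineBundle.setoid X)

/-- The class of a line bundle in the Picard group. -/
def Pic.mk {X : Scheme.{u}} (L : LineBundle X) : Pic X := Quotient.mk _ L

/-- The group law of the Picard group is the tensor product. -/
instance (X : Scheme.{u}) : CommGroup (Pic X) where
  mul := Quotient.map₂ LineBundle.tensor fun _ _ h _ _ h' => h.tensor h'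
  one := Pic.mk (LineBundle.trivial X)
  inv := Quotient.map LineBundle.dual fun _ _ h => h.dual
  mul_assoc := by
    rintro ⟨L⟩ ⟨M⟩ ⟨N⟩
    refine Quotient.sound (LineBundle.Iso.of_eq ((L.tensor M).tensor N).U id
      (fun p => (p.1.1, (p.1.2, p.2))) (fun _ => le_rfl) (fun _ => (inf_assoc _ _ _).le)
      ((L.tensor M).tensor N).cover fun k l => ?_)
    simp only [LineBundle.tensor_tr, id, mul_assoc]
  one_mul := by
    rintro ⟨L⟩
    refine Quotient.sound (LineBundle.Iso.of_eq L.U (fun i => (⟨⟩, i)) id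
      (fun _ => le_inf le_top le_rfl) (fun _ => le_rfl) L.cover fun k l => ?_)
    simp only [LineBundle.tensor_tr, LineBundle.trivial_tr, id, one_mul]
  mul_one := by
    rintro ⟨L⟩
    refine Quotient.sound (LineBundle.Iso.of_eq L.U (fun i => (i, ⟨⟩)) id
      (fun _ => le_inf le_rfl le_top) (fun _ => le_rfl) L.cover fun k l => ?_)
    simp only [LineBundle.tensor_tr, LineBundle.trivial_tr, id, mul_one]
  inv_mul_cancel := by
    rintro ⟨L⟩
    refine Quotient.sound (LineBundle.Iso.of_eq L.U (fun i => (i, i)) (fun _ => ⟨⟩)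
      (fun _ => le_inf le_rfl le_rfl) (fun _ => le_top) L.cover fun k l => ?_)
    simp only [LineBundle.tensor_tr, LineBundle.trivial_tr, LineBundle.dual_tr, inv_mul_cancel]
  mul_comm := by
    rintro ⟨L⟩ ⟨M⟩
    refine Quotient.sound (LineBundle.Iso.of_eq (L.tensor M).U id Prod.swap
      (fun _ => le_rfl) (fun _ => (inf_comm _ _).le) (L.tensor M).cover fun k l => ?_)
    simp only [LineBundle.tensor_tr, id, Prod.fst_swap, Prod.snd_swap]
    exact mul_comm _ _

/-- The pull-back homomorphism `f^* : Pic Y → Pic X` of a morphism `f : X ⟶ Y`. -/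
def Pic.pullback {X Y : Scheme.{u}} (f : X ⟶ Y) : Pic Y →* Pic X where
  toFun := Quotient.map (LineBundle.pullback f) fun _ _ h => h.pullback f
  map_one' := Quotient.sound (LineBundle.Iso.of_eq (fun _ : PUnit => ⊤) id id
    (fun _ => le_rfl) (fun _ => le_rfl) (fun x => ⟨⟨⟩, Opens.mem_top x⟩) fun k l => by
      rw [LineBundle.pullback_tr, LineBundle.trivial_tr]
      exact map_one _)
  map_mul' := by
    rintro ⟨L⟩ ⟨M⟩
    refine Quotient.sound (LineBundle.Iso.of_eq (fun p : L.ι × M.ι => f ⁻¹ᵁ L.U p.1 ⊓ f ⁻¹ᵁ M.U p.2)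
      id id (fun _ => le_rfl) (fun _ => le_rfl)
      ((L.pullback f).tensor (M.pullback f)).cover fun k l => ?_)
    rw [LineBundle.tensor_tr, LineBundle.pullback_tr, LineBundle.pullback_tr,
      LineBundle.pullback_tr]
    simp only [LineBundle.tensor, map_mul, LineBundle.tr]
    congr 1
    · exact pullUnit_res _ _ _ _
    · exact pullUnit_res _ _ _ _

/-! ### Projective three-space and the incidence variety -/

/-- The standard grading of `ℂ[x₀, x₁, x₂, x₃]`. -/
abbrev grading : ℕ → Submodule ℂ (MvPolynomial (Fin 4) ℂ) :=
  MvPolynomial.homogeneousSubmodule (Fin 4) ℂ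

instance : GradedAlgebra grading := MvPolynomial.gradedAlgebra

lemma X_mem (i : Fin 4) : (MvPolynomial.X i : MvPolynomial (Fin 4) ℂ) ∈ grading 1 :=
  MvPolynomial.isHomogeneous_X ℂ i

lemma X_mem_smul (i : Fin 4) : (MvPolynomial.X i : MvPolynomial (Fin 4) ℂ) ∈ grading (1 • 1) :=
  MvPolynomial.isHomogeneous_X ℂ i

/-- Complex projective three-space. The dual space `(ℙ³)^∨` is again this scheme, with the
dual homogeneous coordinates. -/
def P3 : Scheme.{0} := Proj grading

/-- The complex numbers as a base scheme. -/
abbrev SpecC : Scheme.{0} := Spec (CommRingCat.of ℂ)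

/-- The structure morphism of `ℙ³`. -/
def P3.toSpecC : P3 ⟶ SpecC :=
  Proj.toSpecZero grading ≫ Spec.map (CommRingCat.ofHom (algebraMap ℂ (grading 0)))

/-- The standard chart `x_i ≠ 0`. -/
def P3.chart (i : Fin 4) : P3.Opens := Proj.basicOpen grading (MvPolynomial.X i)

/-- The fraction `x_k / x_i`. -/
def ratio (i k : Fin 4) : HomogeneousLocalization.Away grading (MvPolynomial.X i) :=
  HomogeneousLocalization.Away.mk grading (X_mem i) 1 (MvPolynomial.X k) (X_mem_smul k)

/-- The regular function `x_k / x_i` on the chart `x_i ≠ 0`. -/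
def P3.coord (i k : Fin 4) : Γ(P3, P3.chart i) :=
  Proj.awayToSection grading (MvPolynomial.X i) (ratio i k)

lemma P3.coord_self (i : Fin 4) : P3.coord i i = 1 := by
  have h : ratio i i = 1 := by
    ext
    rw [ratio, HomogeneousLocalization.Away.val_mk, HomogeneousLocalization.val_one,
      ← Localization.mk_one, Localization.mk_eq_mk_iff, Localization.r_iff_exists]
    exact ⟨1, by simp⟩
  unfold P3.coord
  rw [h]
  exact map_one _

lemma P3.coord_val (i k : Fin 4) (p : P3.chart i) :
    ((P3.coord i k).val p).val = Localization.mk (MvPolynomial.X k) ⟨MvPolynomial.X i, p.2⟩ := by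
  refine (ProjectiveSpectrum.Proj.awayToSection_apply grading _ _ _).trans ?_
  rw [ratio, HomogeneousLocalization.Away.val_mk, Localization.mk_eq_mk', IsLocalization.map_mk',
    Localization.mk_eq_mk']
  simp

lemma P3.coord_mul (i j k : Fin 4) (V : P3.Opens) (hi : V ≤ P3.chart i) (hj : V ≤ P3.chart j) :
    resFun hi (P3.coord i j) * resFun hj (P3.coord j k) = resFun hi (P3.coord i k) := by
  apply Subtype.ext
  funext x
  apply HomogeneousLocalization.val_injective
  have e : ((P3.coord i j).val ⟨x.1, hi x.2⟩).val * ((P3.coord j k).val ⟨x.1, hj x.2⟩).val =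
      ((P3.coord i k).val ⟨x.1, hi x.2⟩).val := by
    refine (congrArg₂ (· * ·) (P3.coord_val i j _) (P3.coord_val j k _)).trans
      (Eq.trans ?_ (P3.coord_val i k _).symm)
    refine (Localization.mk_mul _ _ _ _).trans ?_
    rw [Localization.mk_eq_mk_iff, Localization.r_iff_exists]
    refine ⟨1, ?_⟩
    simp only [Submonoid.coe_mul, OneMemClass.coe_one, one_mul]
    ring
  exact (HomogeneousLocalization.val_mul _ _).trans e

lemma P3.coord_mul_self (i j : Fin 4) (V : P3.Opens) (hi : V ≤ P3.chart i)
    (hj : V ≤ P3.chart j) : resFun hi (P3.coord i j) * resFun hj (P3.coord j i) = 1 := by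
  rw [P3.coord_mul, P3.coord_self, map_one]

lemma P3.chart_cover (x : P3) : ∃ i, x ∈ P3.chart i := by
  have h := Proj.iSup_basicOpen_eq_top grading (MvPolynomial.X : Fin 4 → _) ?_
  · have hx : x ∈ (⊤ : (Proj grading).Opens) := trivial
    rw [← h] at hx
    exact Opens.mem_iSup.mp hx
  · intro p hp
    rw [← Set.image_univ, MvPolynomial.mem_ideal_span_X_image]
    intro m hm
    by_contra! h
    have hm0 : m = 0 := Finsupp.ext fun i => h i (Set.mem_univ i)
    have hp' : GradedRing.proj grading 0 p = 0 := (HomogeneousIdeal.mem_irrelevant_iff _ _).mp hp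
    have h0 : MvPolynomial.homogeneousComponent 0 p = 0 := by
      rw [← hp']
      exact (MvPolynomial.decomposition.decompose'_apply p 0).symm
    rw [MvPolynomial.homogeneousComponent_zero, MvPolynomial.C_eq_zero] at h0
    rw [hm0, MvPolynomial.mem_support_iff] at hm
    exact hm h0

/-- The line bundle `𝒪(1)` on `ℙ³`. The sections on the chart `x_i ≠ 0` are the multiples of `x_i`,
so that the transition functions are `x_j / x_i`. -/
def O1 : LineBundle P3 where
  ι := Fin 4
  U := P3.chart
  cover := P3.chart_cover
  g i j :=
    { val := resFun inf_le_left (P3.coord i j)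
      inv := resFun inf_le_right (P3.coord j i)
      val_inv := P3.coord_mul_self i j _ _ _
      inv_val := P3.coord_mul_self j i _ _ _ }
  cocycle i j k := by
    ext
    simp only [res, Units.val_mul, Units.coe_map, MonoidHom.coe_coe]
    have r : ∀ {U V W : P3.Opens} (h : V ≤ U) (h' : W ≤ V) (a : Γ(P3, U)),
        resFun h' (resFun h a) = resFun (h'.trans h) a := by
      intro U V W h h' a
      simp only [resFun, ← CommRingCat.comp_apply, ← Functor.map_comp]
      rfl
    rw [r, r, r]
    exact P3.coord_mul i j k _ _ _

/-- The product `ℙ³ × (ℙ³)^∨` over `ℂ`. -/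
abbrev P3xP3 : Scheme.{0} := Limits.pullback P3.toSpecC P3.toSpecC

/-- The open subset `x_i ≠ 0`, `ξ_j ≠ 0` of `ℙ³ × (ℙ³)^∨`. -/
def P3xP3.chart (i j : Fin 4) : P3xP3.Opens :=
  (pullback.fst P3.toSpecC P3.toSpecC) ⁻¹ᵁ P3.chart i ⊓
    (pullback.snd P3.toSpecC P3.toSpecC) ⁻¹ᵁ P3.chart j

/-- The regular function `∑ k, (x_k / x_i) * (ξ_k / ξ_j)` on the open subset
`x_i ≠ 0`, `ξ_j ≠ 0` of `ℙ³ × (ℙ³)^∨`. -/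
def incidenceForm (i j : Fin 4) : Γ(P3xP3, P3xP3.chart i j) :=
  ∑ k : Fin 4,
    (pullback.fst P3.toSpecC P3.toSpecC).appLE (P3.chart i) (P3xP3.chart i j) inf_le_left
        (P3.coord i k) *
      (pullback.snd P3.toSpecC P3.toSpecC).appLE (P3.chart j) (P3xP3.chart i j) inf_le_right
        (P3.coord j k)

/-- The closed subset `∑ k, x_k * ξ_k = 0` of `ℙ³ × (ℙ³)^∨`, i.e. the set of pairs of a point and a
plane that contains it. -/
def incidenceLocus : Closeds P3xP3 :=
  Opens.compl (⨆ (i : Fin 4) (j : Fin 4), P3xP3.basicOpen (incidenceForm i j))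

/-- The incidence variety `I ⊆ ℙ³ × (ℙ³)^∨`. -/
def Inc : Scheme.{0} := (Scheme.IdealSheafData.vanishingIdeal incidenceLocus).subscheme

/-- The inclusion of the incidence variety. -/
def Inc.incl : Inc ⟶ P3xP3 := (Scheme.IdealSheafData.vanishingIdeal incidenceLocus).subschemeι

/-- The first projection `I → ℙ³`. -/
def Inc.p₁ : Inc ⟶ P3 := Inc.incl ≫ pullback.fst P3.toSpecC P3.toSpecC

/-- The second projection `I → (ℙ³)^∨`. -/
def Inc.p₂ : Inc ⟶ P3 := Inc.incl ≫ pullback.snd P3.toSpecC P3.toSpecC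

/-- The structure morphism of the incidence variety. -/
def Inc.toSpecC : Inc ⟶ SpecC := Inc.p₁ ≫ P3.toSpecC

/-- The class `H₁ = p₁^* 𝒪(1)`. -/
def H₁ : Pic Inc := Pic.pullback Inc.p₁ (Pic.mk O1)

/-- The class `H₂ = p₂^* 𝒪(1)`. -/
def H₂ : Pic Inc := Pic.pullback Inc.p₂ (Pic.mk O1)

/-! ### Blow-ups -/

/-- The closed subscheme defined by an ideal sheaf is an effective Cartier divisor: the ideal sheaf
is locally generated by one element that is not a zero divisor. -/
def IsCartier {X : Scheme.{u}} (J : X.IdealSheafData) : Prop :=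
  ∀ x : X, ∃ U : X.affineOpens, x ∈ U.1 ∧ ∃ a ∈ nonZeroDivisors Γ(X, U.1), J.ideal U = Ideal.span {a}

/-- `π : B ⟶ Y` is the blow-up of `Y` along the closed subscheme defined by the ideal sheaf `J`:
it is universal among the morphisms to `Y` under which the inverse image of this subscheme
is an effective Cartier divisor. -/
def IsBlowup {B Y : Scheme.{u}} (J : Y.IdealSheafData) (π : B ⟶ Y) : Prop :=
  IsCartier (J.comap π) ∧
    ∀ (T : Scheme.{u}) (t : T ⟶ Y), IsCartier (J.comap t) → ∃! l : T ⟶ B, l ≫ π = t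

/-- The exceptional divisor of a blow-up `π : B ⟶ Y` along `J`, the inverse image of the centre. -/
def excDiv {B Y : Scheme.{u}} (J : Y.IdealSheafData) (π : B ⟶ Y) : Scheme.{u} :=
  (J.comap π).subscheme

/-- The inclusion of the exceptional divisor. -/
def excIncl {B Y : Scheme.{u}} (J : Y.IdealSheafData) (π : B ⟶ Y) : excDiv J π ⟶ B :=
  (J.comap π).subschemeι

end

end IncidenceBlowup

/-! On the open set $x_i\ne0$, $\xi_j\ne0$ with $i\ne j$, the incidence equation can be solved for
$\xi_i/\xi_j$, so this chart is an affine space $\mathbb A^5$ (`isIso_chartToSpec`). These charts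
cover $I$, hence $I$ is integral with factorial charts.

Generation of $\operatorname{Pic}(I)$ (`exists_eq_zpow`): a line bundle is encoded by its local
equations in the function field, up to units of the local rings. On a factorial affine chart the
local equation can be chosen constant (`IsLocalEq.exists_const`). Comparing the charts $(0,3)$ and
$(3,0)$ gives a function invertible on their intersection, hence a constant times a monomial in
$x_3/x_0$ and $\xi_0/\xi_3$. Twisting by powers of $H_1$ and $H_2$ removes the monomial. The bundle
is then trivial on the union of the two charts. Since $x_0\xi_3$ and $x_3\xi_0$ are relatively prime
on every chart, the trivialization extends to all of $I$, as in Hartogs' theorem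
(`mem_unitsAt_of_mem`).

Positivity: if $H_1^aH_2^b$ is globally generated, then $a,b\ge0$ (`nonneg_left`, `nonneg_right`).
This is seen on a line of points in a fixed plane and on a pencil of planes through a fixed point,
where the degree is $a$ and $b$ respectively. The trivial bundle is globally generated, so $H_1$ and
$H_2$ are independent.

Automorphisms: pull-back preserves global generation, so an automorphism and its inverse act by
nonnegative integer matrices. Such mutually inverse matrices are permutation matrices
(`nonneg_matrix_mul_eq_one`), which leaves the identity and the exchange.

Blow-up: the copies of $I$ are reduced, so the set-theoretic invariance of the exceptional divisor
makes $f$ restrict to a morphism of schemes. By irreducibility it sends each copy into one copy, and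
$f^{-1}$ supplies the inverse (`exists_iso_comp_eq_comp`). -/

namespace IncidenceBlowup

noncomputable section

universe u

/-! ### Fractions in domains and factorial domains -/

section Fractions

variable {A K : Type*} [CommRing A] [Field K] [Algebra A K] [IsFractionRing A K]

/-- `f` is a fraction whose denominator is a power of `s`. -/
def DenPow (A : Type*) {K : Type*} [CommRing A] [Field K] [Algebra A K] (s : A) (f : K) : Prop :=
  ∃ (n : ℕ) (a : A), f * algebraMap A K s ^ n = algebraMap A K a

/-- Algebraic Hartogs extension: from $a/s^n=b/t^m$ one gets $at^m=bs^n$, and coprimality forces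
$s^n\mid a$. -/
lemma mem_range_of_denPow [DecompositionMonoid A] {s t : A} (hs : s ≠ 0)
    (hst : IsRelPrime s t) {f : K} (h : DenPow A s f) (h' : DenPow A t f) :
    ∃ a, algebraMap A K a = f := by
  obtain ⟨n, a, ha⟩ := h
  obtain ⟨m, b, hb⟩ := h'
  have hs0 : algebraMap A K s ≠ 0 := by simpa using hs
  have e : a * t ^ m = b * s ^ n := by
    apply IsFractionRing.injective A K
    rw [map_mul, map_mul, ← ha, ← hb, map_pow, map_pow]
    ring
  obtain ⟨c, rfl⟩ : s ^ n ∣ a := (hst.pow).dvd_of_dvd_mul_right (Dvd.intro_left _ e.symm)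
  refine ⟨c, ?_⟩
  rw [map_mul, map_pow, mul_comm] at ha
  exact (mul_left_cancel₀ (pow_ne_zero n hs0) ha).symm

variable [IsDomain A]

/-- The numerators of $f$ and $f^{-1}$ multiply to a power of $uv$, so the numerator of $f$ has no
prime factors except $u$ and $v$. -/
lemma exists_unit_mul_zpow {u v : A} (hu : Prime u) (hv : Prime v) {f : K} (hf : f ≠ 0)
    (h : DenPow A (u * v) f) (h' : DenPow A (u * v) f⁻¹) :
    ∃ (w : Aˣ) (k l : ℤ), f = algebraMap A K w * algebraMap A K u ^ k * algebraMap A K v ^ l := by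
  obtain ⟨n, a, ha⟩ := h
  obtain ⟨m, b, hb⟩ := h'
  have hu0 : algebraMap A K u ≠ 0 := by simpa using hu.ne_zero
  have hv0 : algebraMap A K v ≠ 0 := by simpa using hv.ne_zero
  have e : a * b = u ^ (n + m) * v ^ (n + m) := by
    apply IsFractionRing.injective A K
    rw [map_mul, ← ha, ← hb, map_mul, map_mul, map_pow, map_pow]
    field_simp
    ring
  obtain ⟨i, j, c, d, -, hcd, rfl, -⟩ := mul_eq_mul_prime_pow hv e
  -- With cofactor $1$, what remains after extracting the powers of $u$ is a factorization of $1$,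
  -- hence consists of units.
  obtain ⟨i', j', c', d', -, hcd', rfl, -⟩ :=
    mul_eq_mul_prime_pow (a := 1) hu ((one_mul (u ^ (n + m))).symm ▸ hcd.symm)
  refine ⟨Units.mkOfMulEqOne c' d' hcd'.symm, (i' : ℤ) - n, (i : ℤ) - n, ?_⟩
  rw [map_mul, map_mul, map_mul, map_pow, map_pow] at ha
  rw [Units.val_mkOfMulEqOne, zpow_sub₀ hu0, zpow_sub₀ hv0, zpow_natCast, zpow_natCast,
    zpow_natCast, zpow_natCast]
  rw [mul_pow] at ha
  field_simp
  linear_combination ha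

lemma exists_relPrime_mul [UniqueFactorizationMonoid A] (f : A) {h : A} (hh : h ≠ 0) :
    ∃ c e : A, h = c * e ∧ IsRelPrime c f ∧ ∃ n : ℕ, e ∣ f ^ n := by
  induction h using UniqueFactorizationMonoid.induction_on_prime with
  | h₁ => exact absurd rfl hh
  | h₂ x hx => exact ⟨x, 1, by simp, hx.isRelPrime_left, 0, by simp⟩
  | h₃ a p ha hp ih =>
    obtain ⟨c, e, rfl, hc, n, hn⟩ := ih ha
    by_cases hpf : p ∣ f
    · exact ⟨c, p * e, by ring, hc, n + 1, pow_succ' f n ▸ mul_dvd_mul hpf hn⟩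
    · exact ⟨p * c, e, by ring,
        ((hp.irreducible.isRelPrime_iff_not_dvd).mpr hpf).mul_left hc, n, hn⟩

/-- Patching of local equations $h_k$ on the principal open sets $D(f_k)$. After clearing
denominators, strip from each numerator the part supported on $f_k=0$; the lcm of what remains is
associated to each numerator on $D(f_k)$. -/
lemma exists_common_fraction [UniqueFactorizationMonoid A] {κ : Type*} [Finite κ] (f : κ → A)
    (h : κ → K) (hh : ∀ k, h k ≠ 0) (H : ∀ k l, DenPow A (f k * f l) (h k / h l)) :
    ∃ g : K, g ≠ 0 ∧ ∀ k, DenPow A (f k) (g / h k) ∧ DenPow A (f k) (h k / g) := by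
  classical
  cases nonempty_fintype κ
  let _ : StrongNormalizationMonoid A := UniqueFactorizationMonoid.strongNormalizationMonoid
  let _ : StrongNormalizedGCDMonoid A := UniqueFactorizationMonoid.toStrongNormalizedGCDMonoid A
  obtain ⟨⟨d, hd⟩, hd'⟩ := IsLocalization.exist_integer_multiples_of_finite (nonZeroDivisors A) h
  choose c hc using hd'
  have hd0 : algebraMap A K d ≠ 0 := by simpa using nonZeroDivisors.ne_zero hd
  have hc' : ∀ k, algebraMap A K (c k) = algebraMap A K d * h k := fun k => by
    rw [hc]
    exact Algebra.smul_def d (h k)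
  have hc0 : ∀ k, c k ≠ 0 := fun k h0 => by
    have := hc' k
    rw [h0, map_zero] at this
    exact mul_ne_zero hd0 (hh k) this.symm
  choose a e hae hrel n hn using fun k => exists_relPrime_mul (f k) (hc0 k)
  -- Regularity of $h_k/h_l$ on $D(f_kf_l)$ gives divisibility up to powers of $f_k$ and $f_l$; as
  -- $a_l$ is prime to $f_l$, the power of $f_l$ can be dropped.
  have key : ∀ k l, ∃ m, a l ∣ a k * f k ^ m := fun k l => by
    obtain ⟨m, b, hb⟩ := H k l
    have h1 : c k * (f k * f l) ^ m = b * c l := by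
      apply IsFractionRing.injective A K
      rw [map_mul, map_mul, hc', hc', ← hb, map_pow]
      field_simp [hh l]
    have h2 : a l ∣ (c k * f k ^ m) * f l ^ m := by
      rw [mul_assoc, ← mul_pow, h1, hae l]
      exact ⟨b * e l, by ring⟩
    have h3 := ((hrel l).pow_right (n := m)).dvd_of_dvd_mul_right h2
    refine ⟨n k + m, h3.trans ?_⟩
    rw [hae k, pow_add, mul_assoc]
    exact mul_dvd_mul_left _ (mul_dvd_mul_right (hn k) _)
  choose m hm using key
  let L : A := Finset.univ.lcm a
  have hL : ∀ k, ∃ M, L ∣ a k * f k ^ M := fun k =>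
    ⟨Finset.univ.sup (m k), Finset.lcm_dvd fun l _ => (hm k l).trans
      (mul_dvd_mul_left _ (pow_dvd_pow _ (Finset.le_sup (Finset.mem_univ l))))⟩
  have hL0 : L ≠ 0 := by
    rw [Ne, Finset.lcm_eq_zero_iff]
    rintro ⟨k, -, hk⟩
    exact hc0 k (by rw [hae, hk, zero_mul])
  have hLK : algebraMap A K L ≠ 0 := by simpa using hL0
  have hck : ∀ k, h k = algebraMap A K (c k) / algebraMap A K d := fun k => by
    rw [hc']; field_simp
  have hcK : ∀ k, algebraMap A K (c k) ≠ 0 := fun k => by simpa using hc0 k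
  refine ⟨algebraMap A K L / algebraMap A K d, div_ne_zero hLK hd0, fun k => ⟨?_, ?_⟩⟩
  · obtain ⟨x, hx⟩ := hn k
    obtain ⟨y, hy⟩ : a k ∣ L := Finset.dvd_lcm (Finset.mem_univ k)
    refine ⟨n k, y * x, ?_⟩
    have h1 : L * f k ^ n k = c k * (y * x) := by
      rw [hx, hy, hae k]; ring
    have h2 := congrArg (algebraMap A K) h1
    rw [map_mul, map_mul (algebraMap A K) (c k), map_pow] at h2
    rw [hck k, div_div_div_cancel_right₀ hd0, div_mul_eq_mul_div, h2, mul_div_cancel_left₀ _ (hcK k)]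
  · obtain ⟨M, y, hy⟩ := hL k
    refine ⟨M, y * e k, ?_⟩
    have h1 : c k * f k ^ M = L * (y * e k) := by
      rw [hae k, mul_right_comm, hy]; ring
    have h2 := congrArg (algebraMap A K) h1
    rw [map_mul, map_mul (algebraMap A K) L, map_pow] at h2
    rw [hck k, div_div_div_cancel_right₀ hd0, div_mul_eq_mul_div, h2, mul_div_cancel_left₀ _ hLK]

end Fractions

/-! ### Rational functions on an integral scheme -/

section FunctionField

variable {X : Scheme.{u}} [IsIntegral X]

lemma genericPoint_mem {U : X.Opens} {x : X} (hx : x ∈ U) : genericPoint X ∈ U :=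
  (genericPoint_specializes x).mem_open U.2 hx

/-- A regular function on a non-empty open set, as a rational function. -/
def toK (U : X.Opens) (h : genericPoint X ∈ U) : Γ(X, U) →+* X.functionField :=
  (X.presheaf.germ U (genericPoint X) h).hom

lemma toK_injective (U : X.Opens) (h : genericPoint X ∈ U) : Function.Injective (toK U h) :=
  germ_injective_of_isIntegral _ _ h

lemma toK_res {U V : X.Opens} (i : V ≤ U) (h : genericPoint X ∈ V) (a : Γ(X, U)) :
    toK V h (resFun i a) = toK U (i h) a :=
  X.presheaf.germ_res_apply (homOfLE i) _ h a

/-- An invertible function on a non-empty open set, as a rational function. -/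
def unitK (U : X.Opens) (h : genericPoint X ∈ U) : Γ(X, U)ˣ →* X.functionFieldˣ :=
  Units.map (toK U h)

lemma unitK_injective (U : X.Opens) (h : genericPoint X ∈ U) : Function.Injective (unitK U h) :=
  Units.map_injective (toK_injective U h)

lemma unitK_res {U V : X.Opens} (i : V ≤ U) (h : genericPoint X ∈ V) (a : Γ(X, U)ˣ) :
    unitK V h (res i a) = unitK U (i h) a :=
  Units.ext (toK_res i h _)

/-- The rational functions that are regular at `x`. -/
def regAt (x : X) : Subring X.functionField :=
  (algebraMap (X.presheaf.stalk x) X.functionField).range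

/-- The rational functions that are regular and invertible at `x`. -/
def unitsAt (x : X) : Subgroup X.functionFieldˣ := (regAt x).toSubmonoid.units

lemma mem_unitsAt {x : X} {f : X.functionFieldˣ} :
    f ∈ unitsAt x ↔ (f : X.functionField) ∈ regAt x ∧
      ((f⁻¹ : X.functionFieldˣ) : X.functionField) ∈ regAt x :=
  Submonoid.mem_units_iff _ _

lemma toK_mem_regAt {U : X.Opens} {x : X} (hx : x ∈ U) (a : Γ(X, U)) :
    toK U (genericPoint_mem hx) a ∈ regAt x :=
  have : Nonempty U := ⟨⟨x, hx⟩⟩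
  ⟨X.presheaf.germ U x hx a, Scheme.algebraMap_germ_eq_germToFunctionField X hx a⟩

lemma unitK_mem_unitsAt {U : X.Opens} {x : X} (hx : x ∈ U) (a : Γ(X, U)ˣ) :
    unitK U (genericPoint_mem hx) a ∈ unitsAt x := by
  rw [mem_unitsAt, ← map_inv]
  exact ⟨toK_mem_regAt hx _, toK_mem_regAt hx _⟩

lemma exists_toK_of_mem_regAt {x : X} {f : X.functionField} (hf : f ∈ regAt x) {V : X.Opens}
    (hV : x ∈ V) : ∃ (U : X.Opens) (_ : U ≤ V) (hx : x ∈ U) (a : Γ(X, U)),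
      toK U (genericPoint_mem hx) a = f := by
  obtain ⟨s, rfl⟩ := hf
  obtain ⟨U, hU, a, rfl⟩ := X.presheaf.exists_germ_eq s
  have : Nonempty U := ⟨⟨x, hU⟩⟩
  refine ⟨U ⊓ V, inf_le_right, ⟨hU, hV⟩, resFun inf_le_left a, ?_⟩
  rw [toK_res]
  exact (Scheme.algebraMap_germ_eq_germToFunctionField X hU a).symm

lemma exists_unitK_of_mem_unitsAt {x : X} {f : X.functionFieldˣ} (hf : f ∈ unitsAt x)
    {V : X.Opens} (hV : x ∈ V) : ∃ (U : X.Opens) (_ : U ≤ V) (hx : x ∈ U) (a : Γ(X, U)ˣ),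
      unitK U (genericPoint_mem hx) a = f := by
  rw [mem_unitsAt] at hf
  obtain ⟨U, hUV, hxU, a, ha⟩ := exists_toK_of_mem_regAt hf.1 hV
  obtain ⟨U', hUU', hxU', b, hb⟩ := exists_toK_of_mem_regAt hf.2 hxU
  have e : resFun hUU' a * b = 1 := by
    apply toK_injective U' (genericPoint_mem hxU')
    rw [map_mul, toK_res, ha, hb, map_one, ← Units.val_mul, mul_inv_cancel, Units.val_one]
  refine ⟨U', hUU'.trans hUV, hxU', Units.mkOfMulEqOne _ _ e, Units.ext ?_⟩
  exact (toK_res _ _ _).trans ha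

/-- Local sections representing the same rational function agree on overlaps, because sections of an
integral scheme embed in the function field; so they glue. -/
lemma exists_toK_of_forall {U : X.Opens} (hU : genericPoint X ∈ U) {f : X.functionField}
    (hf : ∀ x ∈ U, f ∈ regAt x) : ∃ a, toK U hU a = f := by
  choose V hVU hxV a ha using fun x : U => exists_toK_of_mem_regAt (hf x.1 x.2) x.2
  have hcov : iSup V = U := le_antisymm (iSup_le hVU) fun x hx =>
    Opens.mem_iSup.mpr ⟨⟨x, hx⟩, hxV ⟨x, hx⟩⟩
  obtain ⟨s, hs, -⟩ := X.sheaf.existsUnique_gluing' V U (fun x => homOfLE (hVU x)) hcov.ge a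
    (fun x y => by
      apply toK_injective (V x ⊓ V y) ⟨genericPoint_mem (hxV x), genericPoint_mem (hxV y)⟩
      exact (toK_res inf_le_left _ (a x)).trans
        ((ha x).trans ((ha y).symm.trans (toK_res inf_le_right _ (a y)).symm)))
  refine ⟨s, ?_⟩
  have := congrArg (toK _ (genericPoint_mem (hxV ⟨_, hU⟩))) (hs ⟨_, hU⟩)
  rw [ha] at this
  rw [← this]
  exact (toK_res (hVU ⟨_, hU⟩) _ s).symm

lemma denPow_of_forall {U : X.Opens} (hU : IsAffineOpen U) [Nonempty U] {s : Γ(X, U)}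
    (hs : s ≠ 0) {f : X.functionField} (hf : ∀ x ∈ X.basicOpen s, f ∈ regAt x) :
    DenPow Γ(X, U) s f := by
  have hη : genericPoint X ∈ U := genericPoint_mem (Classical.arbitrary U).2
  have hηs : genericPoint X ∈ X.basicOpen s := by
    rw [Scheme.mem_basicOpen X s _ hη, isUnit_iff_ne_zero]
    exact fun h => hs (toK_injective U hη (h.trans (map_zero _).symm))
  obtain ⟨a, ha⟩ := exists_toK_of_forall hηs hf
  have := hU.isLocalization_basicOpen s
  obtain ⟨n, b, hb⟩ := IsLocalization.Away.surj s a
  refine ⟨n, b, ?_⟩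
  have := congrArg (toK _ hηs) hb
  rw [map_mul, map_pow, ha] at this
  have r : ∀ c : Γ(X, U), toK _ hηs (algebraMap _ Γ(X, X.basicOpen s) c) =
      algebraMap Γ(X, U) X.functionField c := fun c => toK_res (X.basicOpen_le s) hηs c
  rwa [r, r] at this

end FunctionField

/-! ### Local equations of line bundles on an integral scheme -/

section LocalEquations

variable {X : Scheme.{u}} [IsIntegral X]

/-- A transition function, as a rational function. -/
def LineBundle.gen (L : LineBundle X) (i j : L.ι) (hi : genericPoint X ∈ L.U i)
    (hj : genericPoint X ∈ L.U j) : X.functionFieldˣ :=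
  unitK (L.U i ⊓ L.U j) ⟨hi, hj⟩ (L.g i j)

lemma LineBundle.unitK_tr (L : LineBundle X) (i j : L.ι) {V : X.Opens} (hi : V ≤ L.U i)
    (hj : V ≤ L.U j) (h : genericPoint X ∈ V) :
    unitK V h (L.tr i j V hi hj) = L.gen i j (hi h) (hj h) :=
  unitK_res _ _ _

lemma LineBundle.gen_mul (L : LineBundle X) (i j k : L.ι) (hi : genericPoint X ∈ L.U i)
    (hj : genericPoint X ∈ L.U j) (hk : genericPoint X ∈ L.U k) :
    L.gen i j hi hj * L.gen j k hj hk = L.gen i k hi hk := by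
  let V := L.U i ⊓ L.U j ⊓ L.U k
  have h : genericPoint X ∈ V := ⟨⟨hi, hj⟩, hk⟩
  have hi' : V ≤ L.U i := inf_le_left.trans inf_le_left
  have hj' : V ≤ L.U j := inf_le_left.trans inf_le_right
  have hk' : V ≤ L.U k := inf_le_right
  have := congrArg (unitK V h) (L.tr_mul i j k V hi' hj' hk')
  rwa [map_mul, L.unitK_tr, L.unitK_tr, L.unitK_tr] at this

lemma LineBundle.gen_mem (L : LineBundle X) (i j : L.ι) {x : X} (hi : x ∈ L.U i)
    (hj : x ∈ L.U j) : L.gen i j (genericPoint_mem hi) (genericPoint_mem hj) ∈ unitsAt x :=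
  unitK_mem_unitsAt (U := L.U i ⊓ L.U j) ⟨hi, hj⟩ _

/-- The rational functions `D x` generate a line bundle in the class `p` at the points `x`,
with respect to some rational trivialization. -/
def IsLocalEq (p : Pic X) (D : X → X.functionFieldˣ) : Prop :=
  ∃ (L : LineBundle X) (k : L.ι) (hk : genericPoint X ∈ L.U k), Pic.mk L = p ∧
    ∀ x i (hi : x ∈ L.U i), L.gen i k (genericPoint_mem hi) hk / D x ∈ unitsAt x

lemma LineBundle.isLocalEq_gen (L : LineBundle X) (k : L.ι)
    (hk : genericPoint X ∈ L.U k) (i : X → L.ι) (hi : ∀ x, x ∈ L.U (i x)) :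
    IsLocalEq (Pic.mk L) fun x => L.gen (i x) k (genericPoint_mem (hi x)) hk := by
  refine ⟨L, k, hk, rfl, fun x j hj => ?_⟩
  rw [← L.gen_mul j (i x) k _ (genericPoint_mem (hi x)), mul_div_cancel_right]
  exact L.gen_mem j (i x) hj (hi x)

lemma exists_isLocalEq (p : Pic X) : ∃ D, IsLocalEq p D := by
  obtain ⟨L, rfl⟩ := Quotient.exists_rep p
  obtain ⟨k, hk⟩ := L.cover (genericPoint X)
  choose i hi using L.cover
  exact ⟨_, L.isLocalEq_gen k hk i hi⟩

lemma IsLocalEq.one : IsLocalEq (1 : Pic X) 1 := by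
  refine ⟨LineBundle.trivial X, ⟨⟩, trivial, rfl, fun x i hi => ?_⟩
  have : (LineBundle.trivial X).gen i ⟨⟩ (genericPoint_mem hi) trivial = 1 := map_one _
  rw [this, Pi.one_apply, div_one]
  exact one_mem _

lemma IsLocalEq.mul {p q : Pic X} {D E : X → X.functionFieldˣ} :
    IsLocalEq p D → IsLocalEq q E → IsLocalEq (p * q) (D * E) := by
  rintro ⟨L, k, hk, rfl, h⟩ ⟨M, l, hl, rfl, h'⟩
  refine ⟨L.tensor M, (k, l), ⟨hk, hl⟩, rfl, fun x ij hij => ?_⟩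
  have : (L.tensor M).gen ij (k, l) (genericPoint_mem hij) ⟨hk, hl⟩ =
      L.gen ij.1 k (genericPoint_mem hij.1) hk * M.gen ij.2 l (genericPoint_mem hij.2) hl := by
    unfold LineBundle.gen LineBundle.tensor LineBundle.tr
    rw [map_mul]
    exact congrArg₂ _ (unitK_res _ _ _) (unitK_res _ _ _)
  rw [this, Pi.mul_apply, mul_div_mul_comm]
  exact mul_mem (h x _ hij.1) (h' x _ hij.2)

lemma IsLocalEq.inv {p : Pic X} {D : X → X.functionFieldˣ} :
    IsLocalEq p D → IsLocalEq p⁻¹ D⁻¹ := by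
  rintro ⟨L, k, hk, rfl, h⟩
  refine ⟨L.dual, k, hk, rfl, fun x i hi => ?_⟩
  have : L.dual.gen i k (genericPoint_mem hi) hk = (L.gen i k (genericPoint_mem hi) hk)⁻¹ :=
    map_inv _ _
  rw [this, Pi.inv_apply, inv_div_inv, ← inv_div]
  exact inv_mem (h x _ hi)

lemma IsLocalEq.zpow {p : Pic X} {D : X → X.functionFieldˣ} (h : IsLocalEq p D) (n : ℤ) :
    IsLocalEq (p ^ n) (D ^ n) := by
  -- The pairs of a class and a system of local equations form a subgroup, hence are closed under
  -- integer powers.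
  let S : Subgroup (Pic X × (X → X.functionFieldˣ)) :=
    { carrier := {q | IsLocalEq q.1 q.2}
      mul_mem' := fun h h' => h.mul h'
      one_mem' := .one
      inv_mem' := fun h => h.inv }
  exact S.zpow_mem (x := (p, D)) h n

/-- Multiplication by the rational function $h$ is an isomorphism of the two bundles as soon as it
matches local generators at every point. -/
lemma IsLocalEq.eq {p q : Pic X} {D E : X → X.functionFieldˣ} (hp : IsLocalEq p D)
    (hq : IsLocalEq q E) (h : X.functionFieldˣ) (H : ∀ x, h * D x / E x ∈ unitsAt x) : p = q := by
  obtain ⟨L, k, hk, rfl, hL⟩ := hp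
  obtain ⟨M, l, hl, rfl, hM⟩ := hq
  choose i hi using L.cover
  choose j hj using M.cover
  have key : ∀ x, h * L.gen (i x) k (genericPoint_mem (hi x)) hk /
      M.gen (j x) l (genericPoint_mem (hj x)) hl ∈ unitsAt x := fun x => by
    have := mul_mem (mul_mem (H x) (hL x _ (hi x))) (inv_mem (hM x _ (hj x)))
    convert this using 1
    rw [inv_div, div_eq_mul_inv, div_eq_mul_inv, div_eq_mul_inv, div_eq_mul_inv]
    calc _ = h * L.gen (i x) k (genericPoint_mem (hi x)) hk *
          (M.gen (j x) l (genericPoint_mem (hj x)) hl)⁻¹ * (D x * (D x)⁻¹) * (E x * (E x)⁻¹) := by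
            simp
      _ = _ := by ac_rfl
  -- The ratios of generators, invertible at single points, spread out to neighbourhoods and there
  -- form the family whose coboundary relates the two cocycles.
  choose W hW hxW t ht using fun x => exists_unitK_of_mem_unitsAt (key x)
    (V := L.U (i x) ⊓ M.U (j x)) ⟨hi x, hj x⟩
  refine Quotient.sound ⟨X, W, i, j, fun x => (hW x).trans inf_le_left,
    fun x => (hW x).trans inf_le_right, t, fun x => ⟨x, hxW x⟩, fun x y => ?_⟩
  have hη : genericPoint X ∈ W x ⊓ W y := ⟨genericPoint_mem (hxW x), genericPoint_mem (hxW y)⟩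
  apply unitK_injective _ hη
  rw [map_mul, map_mul, L.unitK_tr, M.unitK_tr, unitK_res, unitK_res, ht, ht,
    ← L.gen_mul (i x) (i y) k (genericPoint_mem (hi x)) (genericPoint_mem (hi y)) hk,
    ← M.gen_mul (j x) (j y) l (genericPoint_mem (hj x)) (genericPoint_mem (hj y)) hl]
  simp only [div_eq_mul_inv, mul_inv]
  generalize L.gen _ _ _ _ = a
  generalize M.gen _ _ _ _ = b
  generalize L.gen _ _ _ _ = c
  generalize M.gen _ _ _ _ = d
  apply Units.ext
  simp only [Units.val_mul, Units.val_inv_eq_inv_val]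
  field_simp

/-- Converse of `IsLocalEq.eq`: an isomorphism of bundles is, at the generic point, multiplication
by one rational function. -/
lemma IsLocalEq.exists_gen {p : Pic X} {D : X → X.functionFieldˣ} (hp : IsLocalEq p D)
    {L : LineBundle X} (hL : Pic.mk L = p) (k : L.ι) (hk : genericPoint X ∈ L.U k) :
    ∃ h : X.functionFieldˣ, ∀ x i (hi : x ∈ L.U i),
      h * L.gen i k (genericPoint_mem hi) hk / D x ∈ unitsAt x := by
  obtain ⟨M, m, hm, rfl, hM⟩ := hp
  obtain ⟨κ, W, ρ, σ, hρ, hσ, t, hW, H⟩ := Quotient.exact hL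
  obtain ⟨o, ho⟩ := hW (genericPoint X)
  refine ⟨(L.gen (ρ o) k (hρ _ ho) hk)⁻¹ * unitK _ ho (t o) * M.gen (σ o) m (hσ _ ho) hm,
    fun x i hi => ?_⟩
  obtain ⟨l, hl⟩ := hW x
  have hl' := genericPoint_mem hl
  have e := congrArg (unitK _ (show genericPoint X ∈ W l ⊓ W o from ⟨hl', ho⟩)) (H l o)
  rw [map_mul, map_mul, L.unitK_tr, M.unitK_tr, unitK_res, unitK_res] at e
  have h1 := mul_mem (mul_mem (L.gen_mem i (ρ l) hi (hρ _ hl)) (unitK_mem_unitsAt hl (t l)))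
    (hM x _ (hσ _ hl))
  convert h1 using 1
  rw [← L.gen_mul i (ρ l) k (genericPoint_mem hi) (hρ _ hl') hk,
    ← L.gen_mul (ρ l) (ρ o) k (hρ _ hl') (hρ _ ho) hk,
    ← M.gen_mul (σ l) (σ o) m (hσ _ hl') (hσ _ ho) hm]
  have e' := eq_mul_inv_of_mul_eq e
  rw [e']
  generalize M.gen _ _ _ _ = b
  generalize L.gen _ _ _ _ = a
  generalize L.gen _ _ _ _ = c
  generalize M.gen _ _ _ _ = d
  simp only [div_eq_mul_inv]
  generalize (D x)⁻¹ = f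
  generalize unitK _ _ (t l) = s
  generalize unitK _ _ (t o) = r
  apply Units.ext
  simp only [Units.val_mul, Units.val_inv_eq_inv_val]
  field_simp

/-- On an affine open set with factorial coordinate ring the local equations of a line bundle can
be chosen constant. -/
lemma IsLocalEq.exists_const {p : Pic X} {D : X → X.functionFieldˣ} (hp : IsLocalEq p D)
    {U : X.Opens} (hU : IsAffineOpen U) [Nonempty U] [UniqueFactorizationMonoid Γ(X, U)] :
    ∃ h : X.functionFieldˣ, ∀ x ∈ U, D x / h ∈ unitsAt x := by
  obtain ⟨L, k, hk, rfl, hL⟩ := hp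
  have hη : genericPoint X ∈ U := genericPoint_mem (Classical.arbitrary U).2
  have := functionField_isFractionRing_of_isAffineOpen X U hU
  choose i hi using L.cover
  -- Principal open subsets of `U`, each inside a trivializing open set of the bundle;
  -- quasi-compactness leaves finitely many of them.
  choose s hs hxs using fun x : {x : X // x ∈ U} =>
    hU.exists_basicOpen_le ⟨x.1, hi x.1⟩ x.2
  obtain ⟨T, hT⟩ : ∃ T : Finset {x : X // x ∈ U}, (U : Set X) ⊆ ⋃ x ∈ T, X.basicOpen (s x) :=
    hU.isCompact.elim_finite_subcover (fun x => X.basicOpen (s x)) (fun x => (X.basicOpen _).2)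
      fun x hx => Set.mem_iUnion.mpr ⟨⟨x, hx⟩, hxs ⟨x, hx⟩⟩
  have hs0 : ∀ x, s x ≠ 0 := fun x h => by
    have := hxs x
    rw [h, Scheme.basicOpen_zero] at this
    exact this
  let h : T → X.functionFieldˣ := fun x => L.gen (i x.1) k (genericPoint_mem (hi _)) hk
  -- The ratio of two generators is a transition function, hence regular on the intersection of the
  -- two principal open sets.
  obtain ⟨g, hg0, hg⟩ := exists_common_fraction (A := Γ(X, U)) (fun x : T => s x)
    (fun x => (h x : X.functionField)) (fun x => (h x).ne_zero) (fun x y => by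
      refine denPow_of_forall hU (mul_ne_zero (hs0 _) (hs0 _)) fun z hz => ?_
      rw [Scheme.basicOpen_mul] at hz
      have e : h x / h y = L.gen (i x.1) (i y.1) (genericPoint_mem (hi _))
          (genericPoint_mem (hi _)) := by
        rw [div_eq_iff_eq_mul, L.gen_mul]
      have := L.gen_mem (i x.1) (i y.1) (hs _ hz.1) (hs _ hz.2)
      have := (mem_unitsAt.mp this).1
      rw [← e, Units.val_div_eq_div_val] at this
      exact this)
  refine ⟨Units.mk0 g hg0, fun x hx => ?_⟩
  obtain ⟨y, hyT, hxy⟩ : ∃ y ∈ T, x ∈ X.basicOpen (s y) := by simpa using hT hx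
  have hreg : ∀ {f : X.functionField}, DenPow Γ(X, U) (s y) f → f ∈ regAt x := by
    rintro f ⟨n, a, ha⟩
    have h1 : IsUnit (resFun (X.basicOpen_le (s y)) (s y)) := RingedSpace.isUnit_res_basicOpen _ _
    obtain ⟨v, hv⟩ := h1
    have h2 : algebraMap Γ(X, U) X.functionField (s y) = unitK _ (genericPoint_mem hxy) v := by
      refine ((toK_res (X.basicOpen_le (s y)) (genericPoint_mem hxy) (s y)).symm.trans ?_)
      rw [← hv]; rfl
    rw [h2] at ha
    have h3 : f = algebraMap Γ(X, U) X.functionField a *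
        (((unitK _ (genericPoint_mem hxy) v)⁻¹ ^ n : X.functionFieldˣ) : X.functionField) := by
      rw [← ha, mul_assoc, ← Units.val_pow_eq_pow_val, ← Units.val_mul, inv_pow, mul_inv_cancel,
        Units.val_one, mul_one]
    rw [h3]
    exact mul_mem (toK_mem_regAt hx a)
      (mem_unitsAt.mp (pow_mem (inv_mem (unitK_mem_unitsAt hxy v)) n)).1
  have hu : h ⟨y, hyT⟩ / Units.mk0 g hg0 ∈ unitsAt x := by
    rw [mem_unitsAt, inv_div, Units.val_div_eq_div_val, Units.val_div_eq_div_val]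
    exact ⟨hreg (hg ⟨y, hyT⟩).2, hreg (hg ⟨y, hyT⟩).1⟩
  have := mul_mem (inv_mem (hL x _ (hs _ hxy))) hu
  rwa [inv_div, div_mul_div_cancel] at this

end LocalEquations

/-! ### The coordinate rings of the charts of the incidence variety -/

/-- The coordinates on the chart `x_i ≠ 0`, `ξ_j ≠ 0` of the incidence variety, for `i ≠ j`. -/
abbrev ChartVar (i j : Fin 4) : Type := {k : Fin 4 // k ≠ i} ⊕ {k : Fin 4 // k ≠ i ∧ k ≠ j}

/-- The coordinate ring of the chart `x_i ≠ 0`, `ξ_j ≠ 0` of the incidence variety, for `i ≠ j`. -/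
abbrev ChartRing (i j : Fin 4) : Type := MvPolynomial (ChartVar i j) ℂ

namespace ChartRing

/-- The function `x_k / x_i`. -/
def y (i j k : Fin 4) : ChartRing i j :=
  if h : k = i then 1 else MvPolynomial.X (Sum.inl ⟨k, h⟩)

/-- The function `ξ_k / ξ_j` for `k ≠ i`, and zero for `k = i`. -/
def z' (i j k : Fin 4) : ChartRing i j :=
  if h : k ≠ i then if h' : k ≠ j then MvPolynomial.X (Sum.inr ⟨k, h, h'⟩) else 1 else 0

/-- The function `ξ_k / ξ_j`. -/
def z (i j k : Fin 4) : ChartRing i j :=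
  if k = i then -∑ m, y i j m * z' i j m else z' i j k

variable {i j : Fin 4}

lemma y_self : y i j i = 1 := dif_pos rfl

lemma y_of_ne {k : Fin 4} (h : k ≠ i) : y i j k = MvPolynomial.X (Sum.inl ⟨k, h⟩) := dif_neg h

lemma z'_self : z' i j i = 0 := by simp [z']

lemma z_self (hij : i ≠ j) : z i j j = 1 := by simp [z, z', hij.symm]

lemma z_of_ne {k : Fin 4} (h : k ≠ i) (h' : k ≠ j) :
    z i j k = MvPolynomial.X (Sum.inr ⟨k, h, h'⟩) := by simp [z, z', h, h']

lemma sum_update {R : Type*} [CommRing R] {v w w' : Fin 4 → R} (hv : v i = 1) (hw' : w' i = 0)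
    (h : ∀ k ≠ i, w k = w' k) : ∑ k, v k * w k = w i + ∑ k, v k * w' k := by
  rw [← Finset.add_sum_erase _ _ (Finset.mem_univ i), ← Finset.add_sum_erase _ _ (Finset.mem_univ i),
    hv, hw', mul_zero, zero_add, one_mul]
  exact congrArg _ (Finset.sum_congr rfl fun k hk => by rw [h k (Finset.ne_of_mem_erase hk)])

lemma sum_y_mul_z (i j : Fin 4) : ∑ k, y i j k * z i j k = 0 := by
  rw [sum_update (w := z i j) y_self z'_self fun k hk => if_neg hk, z, if_pos rfl, neg_add_cancel]

lemma hom_ext {R : Type*} [CommRing R] {f g : ChartRing i j →+* R}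
    (hC : ∀ c : ℂ, f (MvPolynomial.C c) = g (MvPolynomial.C c))
    (hy : ∀ k, f (y i j k) = g (y i j k)) (hz : ∀ k, f (z i j k) = g (z i j k)) : f = g := by
  refine MvPolynomial.ringHom_ext hC ?_
  rintro (⟨k, hk⟩ | ⟨k, hk, hk'⟩)
  · rw [← y_of_ne hk, hy]
  · rw [← z_of_ne hk hk', hz]

section lift

variable {R : Type*} [CommRing R] (c : ℂ →+* R) (v w : Fin 4 → R)

/-- The homomorphism that is given by a point of the chart. -/
def lift (i j : Fin 4) : ChartRing i j →+* R :=
  MvPolynomial.eval₂Hom c (Sum.elim (fun k => v k.1) (fun k => w k.1))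

lemma lift_C (a : ℂ) : lift c v w i j (MvPolynomial.C a) = c a := MvPolynomial.eval₂Hom_C _ _ _

variable {v w}

lemma lift_y (hv : v i = 1) (k : Fin 4) : lift c v w i j (y i j k) = v k := by
  by_cases h : k = i
  · subst h
    rw [y_self, map_one, hv]
  · rw [y_of_ne h]
    exact MvPolynomial.eval₂Hom_X' _ _ _

/-- Only $k=i$ needs an argument: there the relation $\sum v_kw_k=0$ with $v_i=1$ determines $w_i$
from the other entries. -/
lemma lift_z (hv : v i = 1) (hw : w j = 1) (hvw : ∑ k, v k * w k = 0) (k : Fin 4) :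
    lift c v w i j (z i j k) = w k := by
  have h0 : ∀ k, k ≠ i → lift c v w i j (z' i j k) = w k := fun k hk => by
    by_cases h : k = j
    · subst h
      simp [z', hk, hw]
    · simp only [z', hk, h, ne_eq, not_false_eq_true, dite_true]
      exact MvPolynomial.eval₂Hom_X' _ _ _
  by_cases hk : k = i
  · subst hk
    rw [z, if_pos rfl, map_neg, map_sum]
    rw [sum_update hv (w' := fun m => lift c v w k j (z' k j m)) (by rw [z'_self, map_zero])
      fun m hm => (h0 m hm).symm] at hvw
    simp only [map_mul, lift_y c hv]
    exact (eq_neg_of_add_eq_zero_left hvw).symm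
  · rw [z, if_neg hk, h0 k hk]

end lift

/-- The exchange of points and planes. -/
def swap (i j : Fin 4) : ChartRing i j →+* ChartRing j i :=
  lift MvPolynomial.C (z j i) (y j i) i j

lemma swap_y (hij : i ≠ j) (k : Fin 4) : swap i j (y i j k) = z j i k :=
  lift_y _ (z_self hij.symm) k

lemma swap_z (hij : i ≠ j) (k : Fin 4) : swap i j (z i j k) = y j i k :=
  lift_z _ (z_self hij.symm) y_self (by simpa only [mul_comm] using sum_y_mul_z j i) k

lemma swap_swap (hij : i ≠ j) : (swap j i).comp (swap i j) = RingHom.id _ := by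
  refine hom_ext (fun c => ?_) (fun k => ?_) fun k => ?_
  · simp only [swap, RingHom.comp_apply, lift_C, RingHom.id_apply]
  · rw [RingHom.comp_apply, swap_y hij, swap_z hij.symm, RingHom.id_apply]
  · rw [RingHom.comp_apply, swap_z hij, swap_y hij.symm, RingHom.id_apply]

/-- The exchange of points and planes, as an isomorphism. -/
def swapEquiv (hij : i ≠ j) : ChartRing i j ≃+* ChartRing j i :=
  RingEquiv.ofRingHom (swap i j) (swap j i) (swap_swap hij.symm) (swap_swap hij)

lemma prime_y {k : Fin 4} (h : k ≠ i) : Prime (y i j k) := by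
  rw [y_of_ne h]
  exact MvPolynomial.X_prime

/-- For $k=i$ this function is not a variable but a quadratic polynomial; the exchange of points and
planes turns it into a variable. -/
lemma prime_z (hij : i ≠ j) {k : Fin 4} (h : k ≠ j) : Prime (z i j k) := by
  rw [← swap_y hij.symm k]
  exact (MulEquiv.prime_iff (swapEquiv hij.symm)).mpr (prime_y h)

lemma not_y_dvd (hij : i ≠ j) {a : Fin 4} (ha : a ≠ i) :
    (∀ b ≠ a, ¬ y i j a ∣ y i j b) ∧ ∀ b, ¬ y i j a ∣ z i j b := by
  -- A point of the chart where the $a$-th coordinate of the point vanishes and all other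
  -- coordinates of point and plane do not. Besides $i$, two nonzero entries of `v` are left, each
  -- contributing $1$ to the incidence sum, whence the $-2$.
  let v : Fin 4 → ℂ := Function.update 1 a 0
  let w : Fin 4 → ℂ := Function.update 1 i (-2)
  have hv : v i = 1 := Function.update_of_ne ha.symm _ _
  have hw : w j = 1 := Function.update_of_ne hij.symm _ _
  have hvw : ∑ k, v k * w k = 0 := by
    clear hv hw
    revert ha
    simp only [v, w, Fin.sum_univ_four]
    fin_cases a <;> fin_cases i <;> simp [Function.update] <;> norm_num
  have hva : lift (RingHom.id ℂ) v w i j (y i j a) = 0 := by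
    rw [lift_y _ hv]
    exact Function.update_self _ _ _
  have key : ∀ p, y i j a ∣ p → lift (RingHom.id ℂ) v w i j p = 0 := by
    rintro _ ⟨q, rfl⟩
    rw [map_mul, hva, zero_mul]
  refine ⟨fun b hb h => ?_, fun b h => ?_⟩
  · have := key _ h
    rw [lift_y _ hv] at this
    simp [v, Function.update_of_ne hb] at this
  · have := key _ h
    rw [lift_z _ hv hw hvw] at this
    by_cases hb : b = i
    · simp [w, hb] at this
    · simp [w, Function.update_of_ne hb] at this

lemma not_z_dvd (hij : i ≠ j) {a : Fin 4} (ha : a ≠ j) :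
    (∀ b ≠ a, ¬ z i j a ∣ z i j b) ∧ ∀ b, ¬ z i j a ∣ y i j b := by
  have h := not_y_dvd hij.symm ha
  refine ⟨fun b hb hd => h.1 b hb ?_, fun b hd => h.2 b ?_⟩
  · simpa only [swap_z hij] using map_dvd (swap i j) hd
  · simpa only [swap_z hij, swap_y hij] using map_dvd (swap i j) hd

/-- Each factor is prime or $1$, and `not_y_dvd`, `not_z_dvd` exclude common factors. Geometrically,
the charts $(a,b)$ and $(a',b')$ together miss only codimension at least two. -/
lemma isRelPrime_mul (hij : i ≠ j) {a a' b b' : Fin 4} (ha : a ≠ a') (hb : b ≠ b') :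
    IsRelPrime (y i j a * z i j b) (y i j a' * z i j b') := by
  have h1 : IsRelPrime (y i j a) (y i j a' * z i j b') := by
    by_cases h : a = i
    · rw [h, y_self]
      exact isRelPrime_one_left
    · have := (prime_y (j := j) h).irreducible
      exact (this.isRelPrime_iff_not_dvd.mpr ((not_y_dvd hij h).1 _ ha.symm)).mul_right
        (this.isRelPrime_iff_not_dvd.mpr ((not_y_dvd hij h).2 _))
  have h2 : IsRelPrime (z i j b) (y i j a' * z i j b') := by
    by_cases h : b = j
    · rw [h, z_self hij]
      exact isRelPrime_one_left
    · have := (prime_z hij h).irreducible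
      exact (this.isRelPrime_iff_not_dvd.mpr ((not_z_dvd hij h).2 _)).mul_right
        (this.isRelPrime_iff_not_dvd.mpr ((not_z_dvd hij h).1 _ hb.symm))
  exact h1.mul_left h2

lemma y_ne_zero (k : Fin 4) : y i j k ≠ 0 := by
  by_cases h : k = i
  · rw [h, y_self]
    exact one_ne_zero
  · exact (prime_y h).ne_zero

lemma z_ne_zero (hij : i ≠ j) (k : Fin 4) : z i j k ≠ 0 := by
  by_cases h : k = j
  · rw [h, z_self hij]
    exact one_ne_zero
  · exact (prime_z hij h).ne_zero

lemma exists_eq_C_of_isUnit {p : ChartRing i j} (h : IsUnit p) : ∃ c : ℂ, p = MvPolynomial.C c := by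
  obtain ⟨c, -, hc⟩ := MvPolynomial.isUnit_iff_eq_C_of_isReduced.mp h
  exact ⟨c, hc⟩

end ChartRing

/-! ### Morphisms to projective space and to the incidence variety -/

/-- The localization of the polynomial ring at `x_i`. -/
abbrev Loc (i : Fin 4) : Type := Localization.Away (MvPolynomial.X i : MvPolynomial (Fin 4) ℂ)

/-- The constants in the homogeneous localization. -/
def awayC (i : Fin 4) : ℂ →+* HomogeneousLocalization.Away grading (MvPolynomial.X i) :=
  (HomogeneousLocalization.fromZeroRingHom grading _).comp (algebraMap ℂ (grading 0))

lemma val_awayC (i : Fin 4) (c : ℂ) :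
    (awayC i c).val = algebraMap (MvPolynomial (Fin 4) ℂ) (Loc i) (MvPolynomial.C c) := by
  rw [← Localization.mk_one_eq_algebraMap]
  rfl

lemma val_ratio (i k : Fin 4) : (ratio i k).val *
    algebraMap (MvPolynomial (Fin 4) ℂ) (Loc i) (MvPolynomial.X i) =
      algebraMap _ _ (MvPolynomial.X k : MvPolynomial (Fin 4) ℂ) := by
  rw [ratio, HomogeneousLocalization.Away.val_mk, Localization.mk_eq_mk']
  simp only [pow_one]
  exact IsLocalization.mk'_spec _ _ _

/-- Dehomogenization: each monomial of $a$ has degree $n$, so $x_i^n$ can be distributed over its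
$n$ factors $x_k/x_i$. -/
lemma eval₂_ratio_mul_pow (i : Fin 4) (n : ℕ) (a : MvPolynomial (Fin 4) ℂ)
    (ha : a ∈ grading n) : (MvPolynomial.eval₂Hom (awayC i) (ratio i) a).val *
      algebraMap (MvPolynomial (Fin 4) ℂ) (Loc i) (MvPolynomial.X i) ^ n =
        algebraMap _ _ a := by
  rw [← HomogeneousLocalization.algebraMap_apply]
  conv_lhs => rw [a.as_sum]
  conv_rhs => rw [a.as_sum]
  rw [map_sum, map_sum, map_sum, Finset.sum_mul]
  refine Finset.sum_congr rfl fun d hd => ?_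
  have hd' : ∑ k, d k = n := by
    have h := ha (MvPolynomial.mem_support_iff.mp hd)
    rw [← h, Finsupp.weight_apply, Finsupp.sum_fintype _ _ (fun _ => by simp)]
    simp
  rw [MvPolynomial.coe_eval₂Hom, MvPolynomial.eval₂_monomial, MvPolynomial.monomial_eq, map_mul,
    map_mul, Finsupp.prod_fintype _ _ (fun _ => pow_zero _),
    Finsupp.prod_fintype _ _ (fun _ => pow_zero _), map_prod, map_prod, ← hd',
    ← Finset.prod_pow_eq_pow_sum, mul_assoc, ← Finset.prod_mul_distrib]
  refine congrArg₂ _ (val_awayC i _) (Finset.prod_congr rfl fun k _ => ?_)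
  rw [map_pow, map_pow, ← mul_pow, HomogeneousLocalization.algebraMap_apply, val_ratio]

lemma away_eq_eval₂ (i : Fin 4) (n : ℕ) (a : MvPolynomial (Fin 4) ℂ) (ha : a ∈ grading (n • 1)) :
    HomogeneousLocalization.Away.mk grading (X_mem i) n a ha =
      MvPolynomial.eval₂Hom (awayC i) (ratio i) a := by
  apply HomogeneousLocalization.val_injective
  have hu : IsUnit (algebraMap (MvPolynomial (Fin 4) ℂ) (Loc i)
      (MvPolynomial.X i) ^ n) :=
    (IsLocalization.Away.algebraMap_isUnit (S := Loc i) (MvPolynomial.X i : MvPolynomial (Fin 4) ℂ)).pow n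
  rw [← hu.mul_left_inj, eval₂_ratio_mul_pow i n a (by simpa using ha),
    HomogeneousLocalization.Away.val_mk, Localization.mk_eq_mk', ← map_pow]
  exact IsLocalization.mk'_spec _ _ _

/-- By `away_eq_eval₂` every fraction is a polynomial in the $x_k/x_i$ with constant coefficients.
-/
lemma away_hom_ext {i : Fin 4} {S : Type*} [CommRing S]
    {f g : HomogeneousLocalization.Away grading (MvPolynomial.X i) →+* S}
    (hC : ∀ c, f (awayC i c) = g (awayC i c)) (h : ∀ k, f (ratio i k) = g (ratio i k)) :
    f = g := by
  ext x
  obtain ⟨n, a, ha, rfl⟩ := HomogeneousLocalization.Away.mk_surjective grading (X_mem i) x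
  rw [away_eq_eval₂]
  have : f.comp (MvPolynomial.eval₂Hom (awayC i) (ratio i)) =
      g.comp (MvPolynomial.eval₂Hom (awayC i) (ratio i)) :=
    MvPolynomial.ringHom_ext (fun c => by simpa using hC c) fun k => by simpa using h k
  exact congrArg (fun φ => φ a) this

/-- Evaluation of homogeneous fractions at a vector whose `i`-th coordinate is `1`. -/
def awayEval {R : Type*} [CommRing R] (c : ℂ →+* R) (v : Fin 4 → R) (i : Fin 4) (hv : v i = 1) :
    HomogeneousLocalization.Away grading (MvPolynomial.X i) →+* R :=
  (IsLocalization.Away.lift (S := Loc i) (MvPolynomial.X i : MvPolynomial (Fin 4) ℂ)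
    (g := MvPolynomial.eval₂Hom c v) (by simp [hv])).comp
      (algebraMap _ (Loc i))

section awayEval

variable {R : Type*} [CommRing R] (c : ℂ →+* R) (v : Fin 4 → R) (i : Fin 4) (hv : v i = 1)

lemma awayEval_awayC (a : ℂ) : awayEval c v i hv (awayC i a) = c a := by
  rw [awayEval, RingHom.comp_apply, HomogeneousLocalization.algebraMap_apply, val_awayC,
    IsLocalization.Away.lift_eq]
  simp

lemma awayEval_ratio (k : Fin 4) : awayEval c v i hv (ratio i k) = v k := by
  have h := congrArg (IsLocalization.Away.lift (S := Loc i)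
    (MvPolynomial.X i : MvPolynomial (Fin 4) ℂ) (g := MvPolynomial.eval₂Hom c v) (by simp [hv])) (val_ratio i k)
  rw [map_mul, IsLocalization.Away.lift_eq, IsLocalization.Away.lift_eq] at h
  simp only [MvPolynomial.coe_eval₂Hom, MvPolynomial.eval₂_X, hv, mul_one] at h
  exact h

end awayEval

/-- The open immersion of the standard chart of `ℙ³`. -/
def P3.chartι (i : Fin 4) :
    Spec (.of (HomogeneousLocalization.Away grading (MvPolynomial.X i))) ⟶ P3 :=
  Proj.awayι grading (MvPolynomial.X i) (X_mem i) one_pos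

instance (i : Fin 4) : IsOpenImmersion (P3.chartι i) := by
  unfold P3.chartι
  exact inferInstanceAs (IsOpenImmersion (Proj.awayι _ _ _ _))

lemma P3.opensRange_chartι (i : Fin 4) : (P3.chartι i).opensRange = P3.chart i :=
  Proj.opensRange_awayι _ _ _ _

lemma P3.chartι_toSpecC (i : Fin 4) :
    P3.chartι i ≫ P3.toSpecC = Spec.map (CommRingCat.ofHom (awayC i)) := by
  unfold P3.chartι P3.toSpecC
  refine (Proj.awayι_toSpecZero_assoc grading _ (X_mem i) one_pos _).trans ?_
  rw [← Spec.map_comp]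
  rfl

lemma P3.le_preimage_chartι (i : Fin 4) : ⊤ ≤ P3.chartι i ⁻¹ᵁ P3.chart i := fun x _ => by
  change P3.chartι i x ∈ P3.chart i
  rw [← P3.opensRange_chartι]
  exact ⟨x, rfl⟩

lemma P3.chartι_coord (i k : Fin 4) :
    (P3.chartι i).appLE (P3.chart i) ⊤ (P3.le_preimage_chartι i) (P3.coord i k) =
      (Scheme.ΓSpecIso (.of (HomogeneousLocalization.Away grading (MvPolynomial.X i)))).inv
        (ratio i k) := by
  have h : Proj.awayToSection grading (MvPolynomial.X i) ≫
      (P3.chartι i).appLE (P3.chart i) ⊤ (P3.le_preimage_chartι i) =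
      (Scheme.ΓSpecIso (.of (HomogeneousLocalization.Away grading (MvPolynomial.X i)))).inv := by
    let V := Proj.basicOpen grading (MvPolynomial.X i)
    let e := Proj.basicOpenIsoSpec grading _ (X_mem i) one_pos
    have h1 : (P3.chartι i).appLE (P3.chart i) ⊤ (P3.le_preimage_chartι i) =
        V.topIso.inv ≫ e.inv.appTop := by
      change (e.inv ≫ V.ι).appLE V ⊤ _ = _
      rw [← Scheme.Hom.appLE_comp_appLE e.inv V.ι V ⊤ ⊤ V.ι_preimage_self.ge le_top,
        Scheme.Opens.ι_appLE]
      exact congrArg₂ (· ≫ ·) rfl (Scheme.Hom.appLE_eq_app e.inv)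
    have h2 : e.hom.appTop = _ := Proj.basicOpenToSpec_app_top grading (MvPolynomial.X i)
    have h3 : e.hom.appTop ≫ e.inv.appTop = 𝟙 _ := by
      rw [← Scheme.Hom.comp_appTop, e.inv_hom_id, Scheme.Hom.id_appTop]
    rw [h1, ← cancel_epi (Scheme.ΓSpecIso _).hom, Iso.hom_inv_id, ← h3, h2]
    simp only [Category.assoc]
    rfl
  exact congrArg (fun φ => φ.hom (ratio i k)) h

lemma appLE_comp_apply {X Y Z : Scheme.{u}} (f : X ⟶ Y) (g : Y ⟶ Z) {U : Z.Opens} {V : Y.Opens}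
    {W : X.Opens} (h : V ≤ g ⁻¹ᵁ U) (h' : W ≤ f ⁻¹ᵁ V) (h'' : W ≤ (f ≫ g) ⁻¹ᵁ U) (a : Γ(Z, U)) :
    (f ≫ g).appLE U W h'' a = f.appLE V W h' (g.appLE U V h a) := by
  rw [← CommRingCat.comp_apply, Scheme.Hom.appLE_comp_appLE]

lemma resFun_appLE {X Y : Scheme.{u}} (f : X ⟶ Y) {U : Y.Opens} {V W : X.Opens}
    (h : V ≤ f ⁻¹ᵁ U) (h' : W ≤ V) (a : Γ(Y, U)) :
    resFun h' (f.appLE U V h a) = f.appLE U W (h'.trans h) a := by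
  simp only [← CommRingCat.comp_apply, Scheme.Hom.appLE_map]

lemma appLE_resFun {X Y : Scheme.{u}} (f : X ⟶ Y) {U U' : Y.Opens} {V : X.Opens}
    (h : V ≤ f ⁻¹ᵁ U) (h' : U ≤ U') (a : Γ(Y, U')) :
    f.appLE U V h (resFun h' a) = f.appLE U' V (preimage_le f h h') a := by
  simp only [← CommRingCat.comp_apply, Scheme.Hom.map_appLE]

lemma appLE_top {X Y : Scheme.{u}} (f : X ⟶ Y) : f.appLE ⊤ ⊤ le_top = f.appTop :=
  Scheme.Hom.appLE_eq_app f

namespace P3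

section pt

variable {R : Type} [CommRing R] (c : ℂ →+* R) (v : Fin 4 → R) (i : Fin 4) (hv : v i = 1)

/-- The morphism to `ℙ³` that is given by a vector of functions whose `i`-th coordinate is `1`. -/
def pt : Spec (.of R) ⟶ P3 :=
  Spec.map (CommRingCat.ofHom (awayEval c v i hv)) ≫ chartι i

lemma le_preimage_pt : ⊤ ≤ pt c v i hv ⁻¹ᵁ chart i :=
  fun _ _ => le_preimage_chartι i (Opens.mem_top _)

lemma pt_toSpecC : pt c v i hv ≫ toSpecC = Spec.map (CommRingCat.ofHom c) := by
  rw [pt, Category.assoc, chartι_toSpecC, ← Spec.map_comp, ← CommRingCat.ofHom_comp]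
  congr 2
  ext a
  exact awayEval_awayC c v i hv a

lemma pt_coord (k : Fin 4) : (pt c v i hv).appLE (chart i) ⊤ (le_preimage_pt c v i hv) (coord i k) =
    (Scheme.ΓSpecIso (.of R)).inv (v k) := by
  refine (appLE_comp_apply _ _ (le_preimage_chartι i) le_top _ _).trans ?_
  rw [chartι_coord]
  have := congrArg (fun φ => φ.hom (ratio i k))
    (Scheme.ΓSpecIso_inv_naturality (CommRingCat.ofHom (awayEval c v i hv)))
  refine Eq.trans ?_ (this.symm.trans ?_)
  · rw [appLE_top]
    rfl
  · exact congrArg (Scheme.ΓSpecIso (.of R)).inv (awayEval_ratio c v i hv k)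

end pt

/-- Both morphisms factor through the same affine chart, whose coordinate ring is generated by the
constants and the ratios. -/
lemma hom_ext {T : Scheme.{0}} {f g : T ⟶ P3} {i : Fin 4} (hf : ⊤ ≤ f ⁻¹ᵁ chart i)
    (hg : ⊤ ≤ g ⁻¹ᵁ chart i) (hC : f ≫ toSpecC = g ≫ toSpecC)
    (h : ∀ k, f.appLE (chart i) ⊤ hf (coord i k) = g.appLE (chart i) ⊤ hg (coord i k)) : f = g := by
  have key : ∀ f : T ⟶ P3, ⊤ ≤ f ⁻¹ᵁ chart i → ∃ f' : T ⟶ Spec _, f' ≫ chartι i = f := by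
    intro f hf
    refine ⟨IsOpenImmersion.lift (chartι i) f ?_, IsOpenImmersion.lift_fac _ _ _⟩
    rintro _ ⟨x, rfl⟩
    change f x ∈ (chartι i).opensRange
    rw [opensRange_chartι]
    exact hf (Opens.mem_top x)
  obtain ⟨f, rfl⟩ := key f hf
  obtain ⟨g, rfl⟩ := key g hg
  congr 1
  apply ext_of_isAffine
  rw [← cancel_epi (Scheme.ΓSpecIso _).inv]
  apply CommRingCat.hom_ext
  apply away_hom_ext
  · intro a
    rw [Category.assoc, Category.assoc, chartι_toSpecC] at hC
    have := congrArg (fun φ => (Scheme.ΓSpecIso (.of ℂ)).inv ≫ Scheme.Hom.appTop φ) hC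
    simp only [Scheme.Hom.comp_appTop] at this
    rw [← Scheme.ΓSpecIso_inv_naturality_assoc, ← Scheme.ΓSpecIso_inv_naturality_assoc] at this
    exact congrArg (fun φ => φ.hom a) this
  · intro k
    have := h k
    rw [appLE_comp_apply _ _ (le_preimage_chartι i) le_top,
      appLE_comp_apply _ _ (le_preimage_chartι i) le_top, chartι_coord] at this
    rw [appLE_top, appLE_top] at this
    exact this

end P3

/-- A morphism from a reduced scheme into the support of an ideal sheaf factors through the
corresponding closed subscheme. -/
lemma exists_lift_subscheme {T X : Scheme.{u}} [IsReduced T] (J : X.IdealSheafData) (f : T ⟶ X)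
    (hf : ∀ x, f x ∈ J.support) : ∃ f' : T ⟶ J.subscheme, f' ≫ J.subschemeι = f := by
  have : J.subschemeι.ker ≤ f.ker := by
    rw [Scheme.IdealSheafData.ker_subschemeι, ← Scheme.IdealSheafData.ofIdeals_ideal J]
    refine Scheme.IdealSheafData.ofIdeals_mono fun U a ha => ?_
    rw [RingHom.mem_ker]
    -- On the reduced scheme `T` a function vanishing at every point is zero, so pointwise vanishing
    -- suffices.
    refine (basicOpen_eq_bot_iff (X := T) _).mp ?_
    rw [← Scheme.preimage_basicOpen, eq_bot_iff]
    intro x hx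
    have hxU : f x ∈ U.1 := X.basicOpen_le a hx
    have := (J.mem_support_iff_of_mem hxU).mp (hf x)
    rw [Scheme.mem_zeroLocus_iff] at this
    exact this a ha hx
  exact ⟨IsClosedImmersion.lift _ f this, IsClosedImmersion.lift_fac _ _ _⟩

lemma P3.basicOpen_coord (i k : Fin 4) :
    P3.basicOpen (P3.coord i k) = P3.chart i ⊓ P3.chart k := by
  apply le_antisymm
  · refine le_inf (P3.basicOpen_le _) fun x hx => ?_
    have hxi : x ∈ (P3.chartι i).opensRange := by
      rw [P3.opensRange_chartι]
      exact P3.basicOpen_le _ hx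
    obtain ⟨y, rfl⟩ := hxi
    have h1 : y ∈ (Spec _).basicOpen ((P3.chartι i).appLE (P3.chart i) ⊤
        (P3.le_preimage_chartι i) (P3.coord i k)) := by
      rw [Scheme.basicOpen_appLE]
      exact ⟨trivial, hx⟩
    rw [P3.chartι_coord] at h1
    have h2 : y ∈ PrimeSpectrum.basicOpen (ratio i k) := by
      rw [basicOpen_eq_of_affine'] at h1
      exact (Iso.inv_hom_id_apply (Scheme.ΓSpecIso (.of
        (HomogeneousLocalization.Away grading (MvPolynomial.X i)))) (ratio i k)) ▸ h1
    change y ∈ P3.chartι i ⁻¹ᵁ P3.chart k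
    have h3 : P3.chartι i ⁻¹ᵁ P3.chart k = _ :=
      Proj.awayι_preimage_basicOpen grading (X_mem i) one_pos (X_mem k) one_pos
    rw [h3]
    have h4 : ratio i k = HomogeneousLocalization.Away.isLocalizationElem (X_mem i) (X_mem k) := by
      ext
      simp only [ratio, HomogeneousLocalization.Away.val_mk, pow_one]
    rwa [← h4]
  · intro x hx
    have h := P3.coord_mul_self i k (P3.chart i ⊓ P3.chart k) inf_le_left inf_le_right
    have h1 : IsUnit (resFun (inf_le_left : P3.chart i ⊓ P3.chart k ≤ _) (P3.coord i k)) :=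
      IsUnit.of_mul_eq_one _ h
    have h2 := P3.basicOpen_of_isUnit h1
    rw [Scheme.basicOpen_res] at h2
    exact (h2.ge hx).2

/-- The subscheme of a closed subset is reduced. -/
lemma isReduced_vanishingIdeal {X : Scheme.{u}} (Z : Closeds X) :
    IsReduced (Scheme.IdealSheafData.vanishingIdeal Z).subscheme := by
  let J := Scheme.IdealSheafData.vanishingIdeal Z
  have : ∀ U : X.affineOpens, IsReduced (J.subschemeCover.openCover.X U) := fun U => by
    have : _root_.IsReduced (Γ(X, U) ⧸ J.ideal U) := by
      rw [← Ideal.isRadical_iff_quotient_reduced]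
      exact PrimeSpectrum.isRadical_vanishingIdeal _
    exact inferInstanceAs (IsReduced (Spec (.of (Γ(X, U) ⧸ J.ideal U))))
  exact (IsReduced.iff_of_openCover _ J.subschemeCover.openCover).mpr this

instance : IsReduced Inc := isReduced_vanishingIdeal _

/-! ### Coordinate functions and standard charts of the incidence variety -/

namespace Inc

lemma incl_mem (x : Inc) : incl x ∈ incidenceLocus := by
  have : incl x ∈ Set.range (Scheme.IdealSheafData.vanishingIdeal incidenceLocus).subschemeι :=
    ⟨x, rfl⟩
  rw [Scheme.IdealSheafData.range_subschemeι] at this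
  exact this

lemma exists_lift {T : Scheme.{0}} [IsReduced T] (f : T ⟶ P3xP3)
    (hf : ∀ x, f x ∈ incidenceLocus) : ∃ f' : T ⟶ Inc, f' ≫ incl = f :=
  exists_lift_subscheme _ f hf

instance : IsClosedImmersion incl :=
  inferInstanceAs
    (IsClosedImmersion (Scheme.IdealSheafData.vanishingIdeal incidenceLocus).subschemeι)

lemma p₂_toSpecC : p₂ ≫ P3.toSpecC = toSpecC := by
  unfold p₂ toSpecC p₁
  rw [Category.assoc, Category.assoc, pullback.condition]

lemma hom_ext {T : Scheme.{0}} {f g : T ⟶ Inc} (h₁ : f ≫ p₁ = g ≫ p₁) (h₂ : f ≫ p₂ = g ≫ p₂) :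
    f = g := by
  rw [← cancel_mono incl]
  apply pullback.hom_ext
  · rw [Category.assoc, Category.assoc]
    exact h₁
  · rw [Category.assoc, Category.assoc]
    exact h₂

/-- The open subset `x_i ≠ 0`, `ξ_j ≠ 0` of the incidence variety. -/
def chart (i j : Fin 4) : Inc.Opens := p₁ ⁻¹ᵁ P3.chart i ⊓ p₂ ⁻¹ᵁ P3.chart j

lemma chart_le₁ (i j : Fin 4) : chart i j ≤ p₁ ⁻¹ᵁ P3.chart i := inf_le_left

lemma chart_le₂ (i j : Fin 4) : chart i j ≤ p₂ ⁻¹ᵁ P3.chart j := inf_le_right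

lemma chart_le_incl (i j : Fin 4) : chart i j ≤ incl ⁻¹ᵁ P3xP3.chart i j := le_rfl

/-- The function `x_k / x_i`. -/
def x (i j k : Fin 4) : Γ(Inc, chart i j) :=
  p₁.appLE (P3.chart i) (chart i j) (chart_le₁ i j) (P3.coord i k)

/-- The function `ξ_k / ξ_j`. -/
def ξ (i j k : Fin 4) : Γ(Inc, chart i j) :=
  p₂.appLE (P3.chart j) (chart i j) (chart_le₂ i j) (P3.coord j k)

/-- The form vanishes at all points of $I$ by definition of the locus, and $I$ is reduced. -/
lemma sum_x_mul_ξ (i j : Fin 4) : ∑ k, x i j k * ξ i j k = 0 := by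
  have h : incl.appLE (P3xP3.chart i j) (chart i j) (chart_le_incl i j) (incidenceForm i j) =
      ∑ k, x i j k * ξ i j k := by
    simp only [incidenceForm, map_sum, map_mul]
    refine Finset.sum_congr rfl fun k _ => congrArg₂ _ ?_ ?_
    · exact (appLE_comp_apply incl _ _ _ _ _).symm
    · exact (appLE_comp_apply incl _ _ _ _ _).symm
  rw [← h, ← basicOpen_eq_bot_iff, Scheme.basicOpen_appLE, eq_bot_iff]
  rintro p ⟨-, hp⟩
  exact incl_mem p (Opens.mem_iSup.mpr ⟨i, Opens.mem_iSup.mpr ⟨j, hp⟩⟩)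

lemma x_self (i j : Fin 4) : x i j i = 1 := by
  rw [x, P3.coord_self, map_one]

lemma ξ_self (i j : Fin 4) : ξ i j j = 1 := by
  rw [ξ, P3.coord_self, map_one]

lemma basicOpen_x (i j k : Fin 4) : Inc.basicOpen (x i j k) = chart i j ⊓ p₁ ⁻¹ᵁ P3.chart k := by
  rw [x, Scheme.basicOpen_appLE, P3.basicOpen_coord]
  ext p
  exact ⟨fun h => ⟨h.1, h.2.2⟩, fun h => ⟨h.1, h.1.1, h.2⟩⟩

lemma basicOpen_ξ (i j k : Fin 4) : Inc.basicOpen (ξ i j k) = chart i j ⊓ p₂ ⁻¹ᵁ P3.chart k := by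
  rw [ξ, Scheme.basicOpen_appLE, P3.basicOpen_coord]
  ext p
  exact ⟨fun h => ⟨h.1, h.2.2⟩, fun h => ⟨h.1, h.1.2, h.2⟩⟩

lemma basicOpen_x_mul_ξ (i j k l : Fin 4) :
    Inc.basicOpen (x i j k * ξ i j l) = chart i j ⊓ chart k l := by
  rw [Scheme.basicOpen_mul, basicOpen_x, basicOpen_ξ]
  ext p
  exact ⟨fun h => ⟨h.1.1, h.1.2, h.2.2⟩, fun h => ⟨⟨h.1, h.2.1⟩, h.1, h.2.2⟩⟩

/-- If $x_i$ and $\xi_i$ are both nonzero at $p$, the relation reads $1+\sum_{k\ne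
i}(x_k/x_i)(\xi_k/\xi_i)=0$. In the local ring at $p$ some summand is then a unit, and $p$ lies in
the chart $(k,i)$. -/
lemma exists_mem_chart (p : Inc) : ∃ i j, i ≠ j ∧ p ∈ chart i j := by
  obtain ⟨i, hi⟩ := P3.chart_cover (p₁ p)
  obtain ⟨j, hj⟩ := P3.chart_cover (p₂ p)
  by_cases hij : i = j
  · subst hij
    have hp : p ∈ chart i i := ⟨hi, hj⟩
    by_contra! H
    let φ := (Inc.presheaf.germ (chart i i) p hp).hom
    have h0 : ∀ k ≠ i, φ (x i i k * ξ i i k) ∈ IsLocalRing.maximalIdeal (Inc.presheaf.stalk p) := by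
      intro k hk
      rw [IsLocalRing.mem_maximalIdeal, mem_nonunits_iff]
      intro hu
      have : p ∈ Inc.basicOpen (x i i k * ξ i i k) := (Scheme.mem_basicOpen Inc _ _ hp).mpr hu
      rw [basicOpen_x_mul_ξ] at this
      exact H k i hk ⟨this.2.1, hj⟩
    have h1 := congrArg φ (sum_x_mul_ξ i i)
    rw [map_sum, ← Finset.add_sum_erase _ _ (Finset.mem_univ i), x_self, ξ_self, mul_one,
      map_one, map_zero] at h1
    have h2 : ∑ k ∈ Finset.univ.erase i, φ (x i i k * ξ i i k) ∈
        IsLocalRing.maximalIdeal (Inc.presheaf.stalk p) :=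
      Ideal.sum_mem _ fun k hk => h0 k (Finset.ne_of_mem_erase hk)
    rw [eq_neg_of_add_eq_zero_right h1, neg_mem_iff] at h2
    exact (IsLocalRing.maximalIdeal.isMaximal _).ne_top ((Ideal.eq_top_iff_one _).mpr h2)
  · exact ⟨i, j, hij, hi, hj⟩

end Inc

lemma le_preimage_top {X Y : Scheme.{u}} (f : X ⟶ Y) (U : X.Opens) : U ≤ f ⁻¹ᵁ ⊤ :=
  fun _ _ => trivial

lemma P3xP3.chart_le₁ (i j : Fin 4) :
    P3xP3.chart i j ≤ (pullback.fst P3.toSpecC P3.toSpecC) ⁻¹ᵁ P3.chart i := inf_le_left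

lemma P3xP3.chart_le₂ (i j : Fin 4) :
    P3xP3.chart i j ≤ (pullback.snd P3.toSpecC P3.toSpecC) ⁻¹ᵁ P3.chart j := inf_le_right

lemma incidenceForm_eq (i j : Fin 4) : incidenceForm i j = ∑ k : Fin 4,
    (pullback.fst P3.toSpecC P3.toSpecC).appLE (P3.chart i) (P3xP3.chart i j)
        (P3xP3.chart_le₁ i j) (P3.coord i k) *
      (pullback.snd P3.toSpecC P3.toSpecC).appLE (P3.chart j) (P3xP3.chart i j)
        (P3xP3.chart_le₂ i j) (P3.coord j k) := rfl

/-- The forms of two charts differ on the overlap by the factor $(x_i/x_k)(\xi_j/\xi_l)$. Hence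
inside one chart the locus is cut out by the form of that chart alone. -/
lemma P3xP3.basicOpen_incidenceForm_le (i j k l : Fin 4) :
    P3xP3.basicOpen (incidenceForm k l) ⊓ P3xP3.chart i j ≤
      P3xP3.basicOpen (incidenceForm i j) := by
  let V := P3xP3.chart k l ⊓ P3xP3.chart i j
  have h₁ : V ≤ (pullback.fst P3.toSpecC P3.toSpecC) ⁻¹ᵁ (P3.chart k ⊓ P3.chart i) :=
    fun _ h => ⟨h.1.1, h.2.1⟩
  have h₂ : V ≤ (pullback.snd P3.toSpecC P3.toSpecC) ⁻¹ᵁ (P3.chart l ⊓ P3.chart j) :=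
    fun _ h => ⟨h.1.2, h.2.2⟩
  have e : resFun (inf_le_left : V ≤ _) (incidenceForm k l) =
      ((pullback.fst P3.toSpecC P3.toSpecC).appLE _ V h₁ (resFun inf_le_left (P3.coord k i)) *
        (pullback.snd P3.toSpecC P3.toSpecC).appLE _ V h₂ (resFun inf_le_left (P3.coord l j))) *
      resFun (inf_le_right : V ≤ _) (incidenceForm i j) := by
    simp only [incidenceForm_eq, map_sum, map_mul, Finset.mul_sum]
    refine Finset.sum_congr rfl fun m _ => ?_
    rw [resFun_appLE, resFun_appLE, resFun_appLE, resFun_appLE, mul_mul_mul_comm,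
      ← appLE_resFun _ h₁ inf_le_left, ← appLE_resFun _ h₂ inf_le_left,
      ← appLE_resFun _ h₁ inf_le_right, ← appLE_resFun _ h₂ inf_le_right, ← map_mul, ← map_mul,
      P3.coord_mul, P3.coord_mul]
  have h := congrArg P3xP3.basicOpen e
  rw [Scheme.basicOpen_mul, Scheme.basicOpen_res, Scheme.basicOpen_res] at h
  intro x hx
  exact (h.le ⟨⟨P3xP3.basicOpen_le _ hx.1, hx.2⟩, hx.1⟩).2.2

/-! ### Points of the incidence variety and the identification of its charts with affine space -/

namespace Inc

section pt

variable {R : Type} [CommRing R] (c : ℂ →+* R) (v w : Fin 4 → R) (i j : Fin 4) (hv : v i = 1)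
  (hw : w j = 1)

/-- The morphism to `ℙ³ × ℙ³` that is given by two vectors of functions. -/
def prePt : Spec (.of R) ⟶ P3xP3 :=
  pullback.lift (P3.pt c v i hv) (P3.pt c w j hw) (by rw [P3.pt_toSpecC, P3.pt_toSpecC])

lemma prePt_fst : prePt c v w i j hv hw ≫ pullback.fst _ _ = P3.pt c v i hv :=
  pullback.lift_fst _ _ _

lemma prePt_snd : prePt c v w i j hv hw ≫ pullback.snd _ _ = P3.pt c w j hw :=
  pullback.lift_snd _ _ _

lemma le_preimage_prePt : ⊤ ≤ prePt c v w i j hv hw ⁻¹ᵁ P3xP3.chart i j := fun x _ => by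
  constructor
  · change (prePt c v w i j hv hw ≫ pullback.fst _ _) x ∈ P3.chart i
    rw [prePt_fst]
    exact P3.le_preimage_pt c v i hv (Opens.mem_top x)
  · change (prePt c v w i j hv hw ≫ pullback.snd _ _) x ∈ P3.chart j
    rw [prePt_snd]
    exact P3.le_preimage_pt c w j hw (Opens.mem_top x)

lemma appLE_congr_hom {X Y : Scheme.{u}} {f g : X ⟶ Y} (e : f = g) {U : Y.Opens} {V : X.Opens}
    (h : V ≤ f ⁻¹ᵁ U) (h' : V ≤ g ⁻¹ᵁ U) (a : Γ(Y, U)) : f.appLE U V h a = g.appLE U V h' a := by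
  subst e
  rfl

lemma prePt_incidenceForm :
    (prePt c v w i j hv hw).appLE _ ⊤ (le_preimage_prePt c v w i j hv hw) (incidenceForm i j) =
      (Scheme.ΓSpecIso (.of R)).inv (∑ k, v k * w k) := by
  simp only [incidenceForm_eq, map_sum, map_mul]
  refine Finset.sum_congr rfl fun k _ => congrArg₂ _ ?_ ?_
  · rw [← P3.pt_coord c v i hv]
    have h : ⊤ ≤ (prePt c v w i j hv hw ≫ pullback.fst _ _) ⁻¹ᵁ P3.chart i := by
      rw [prePt_fst]
      exact P3.le_preimage_pt c v i hv
    rw [← appLE_comp_apply _ _ _ _ h]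
    exact appLE_congr_hom (prePt_fst c v w i j hv hw) _ _ _
  · rw [← P3.pt_coord c w j hw]
    have h : ⊤ ≤ (prePt c v w i j hv hw ≫ pullback.snd _ _) ⁻¹ᵁ P3.chart j := by
      rw [prePt_snd]
      exact P3.le_preimage_pt c w j hw
    rw [← appLE_comp_apply _ _ _ _ h]
    exact appLE_congr_hom (prePt_snd c v w i j hv hw) _ _ _

variable [IsReduced R] (hvw : ∑ k, v k * w k = 0)

include hvw in
lemma exists_pt : ∃ f : Spec (.of R) ⟶ Inc, f ≫ p₁ = P3.pt c v i hv ∧ f ≫ p₂ = P3.pt c w j hw := by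
  have : IsReduced (Spec (.of R)) := by
    have : _root_.IsReduced (CommRingCat.of R) := ‹_›
    infer_instance
  obtain ⟨f, hf⟩ := exists_lift (prePt c v w i j hv hw) fun x hx => by
    obtain ⟨k, hk⟩ := Opens.mem_iSup.mp hx
    obtain ⟨l, hl⟩ := Opens.mem_iSup.mp hk
    have hx' := P3xP3.basicOpen_incidenceForm_le i j k l
      ⟨hl, le_preimage_prePt c v w i j hv hw (Opens.mem_top x)⟩
    have : x ∈ (Spec (.of R)).basicOpen ((prePt c v w i j hv hw).appLE _ ⊤
        (le_preimage_prePt c v w i j hv hw) (incidenceForm i j)) := by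
      rw [Scheme.basicOpen_appLE]
      exact ⟨Opens.mem_top x, hx'⟩
    rw [prePt_incidenceForm, hvw, map_zero, Scheme.basicOpen_zero] at this
    exact this
  refine ⟨f, ?_, ?_⟩
  · rw [← prePt_fst c v w i j hv hw, ← hf, Category.assoc]
    rfl
  · rw [← prePt_snd c v w i j hv hw, ← hf, Category.assoc]
    rfl

end pt

/-- The constants on a chart. -/
def constMap (i j : Fin 4) : CommRingCat.of ℂ ⟶ Γ(Inc, chart i j) :=
  (Scheme.ΓSpecIso (.of ℂ)).inv ≫ toSpecC.appLE ⊤ (chart i j) (le_preimage_top _ _)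

/-- The constants on a chart, as a ring homomorphism. -/
def const (i j : Fin 4) : ℂ →+* Γ(Inc, chart i j) := (constMap i j).hom

/-- The coordinate functions on a chart. -/
def chartHom (i j : Fin 4) : ChartRing i j →+* Γ(Inc, chart i j) :=
  ChartRing.lift (const i j) (x i j) (ξ i j) i j

lemma chartHom_C (i j : Fin 4) (a : ℂ) : chartHom i j (MvPolynomial.C a) = const i j a :=
  ChartRing.lift_C _ _ _ _

lemma chartHom_y (i j k : Fin 4) : chartHom i j (ChartRing.y i j k) = x i j k :=
  ChartRing.lift_y _ (x_self i j) k

lemma chartHom_z (i j k : Fin 4) : chartHom i j (ChartRing.z i j k) = ξ i j k :=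
  ChartRing.lift_z _ (x_self i j) (ξ_self i j) (sum_x_mul_ξ i j) k

/-- The coordinate functions on a chart, as a morphism of `CommRingCat`. -/
def chartMap (i j : Fin 4) : CommRingCat.of (ChartRing i j) ⟶ Γ(Inc, chart i j) :=
  CommRingCat.ofHom (chartHom i j)

/-- The coordinates on a chart, as a morphism to affine space. -/
def chartToSpec (i j : Fin 4) : (chart i j).toScheme ⟶ Spec (.of (ChartRing i j)) :=
  (chart i j).toSpecΓ ≫ Spec.map (chartMap i j)

end Inc

lemma opens_ι_appLE {X : Scheme.{u}} (U : X.Opens) :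
    U.ι.appLE U ⊤ U.ι_preimage_self.ge = U.topIso.inv := by
  rw [Scheme.Opens.ι_appLE]
  rfl

lemma ΓSpecIso_inv_comp_appTop {X : Scheme.{u}} {U : X.Opens} {R : CommRingCat.{u}}
    (φ : R ⟶ Γ(X, U)) :
    (Scheme.ΓSpecIso R).inv ≫ (U.toSpecΓ ≫ Spec.map φ).appTop = φ ≫ U.topIso.inv := by
  rw [Scheme.Hom.comp_appTop, ← Scheme.ΓSpecIso_inv_naturality_assoc, Scheme.Opens.toSpecΓ_appTop,
    Iso.inv_hom_id_assoc]

lemma toSpecΓ_comp_SpecMap {X : Scheme.{u}} (U : X.Opens) {R : CommRingCat.{u}} (g : X ⟶ Spec R) :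
    U.toSpecΓ ≫ Spec.map ((Scheme.ΓSpecIso R).inv ≫ g.appLE ⊤ U (le_preimage_top _ _)) = U.ι ≫ g := by
  apply ext_of_isAffine
  rw [← cancel_epi (Scheme.ΓSpecIso R).inv, ΓSpecIso_inv_comp_appTop, Category.assoc,
    ← opens_ι_appLE, Scheme.Hom.appLE_comp_appLE, appLE_top]

lemma appTop_appLE_apply {X Y Z : Scheme.{u}} (f : X ⟶ Y) (g : Y ⟶ Z) {U : Z.Opens}
    (h : ⊤ ≤ g ⁻¹ᵁ U) (h' : ⊤ ≤ (f ≫ g) ⁻¹ᵁ U) (a : Γ(Z, U)) :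
    f.appTop (g.appLE U ⊤ h a) = (f ≫ g).appLE U ⊤ h' a := by
  rw [appLE_comp_apply f g h (le_preimage_top f ⊤) h', appLE_top]

namespace Inc

lemma le_preimage_ι_comp₁ (i j : Fin 4) : ⊤ ≤ ((chart i j).ι ≫ p₁) ⁻¹ᵁ P3.chart i :=
  fun p _ => p.2.1

lemma le_preimage_ι_comp₂ (i j : Fin 4) : ⊤ ≤ ((chart i j).ι ≫ p₂) ⁻¹ᵁ P3.chart j :=
  fun p _ => p.2.2

lemma ι_comp_p₁_coord (i j k : Fin 4) :
    ((chart i j).ι ≫ p₁).appLE (P3.chart i) ⊤ (le_preimage_ι_comp₁ i j) (P3.coord i k) =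
      (chart i j).topIso.inv (x i j k) := by
  rw [appLE_comp_apply _ _ (chart_le₁ i j) (chart i j).ι_preimage_self.ge, opens_ι_appLE]
  rfl

lemma ι_comp_p₂_coord (i j k : Fin 4) :
    ((chart i j).ι ≫ p₂).appLE (P3.chart j) ⊤ (le_preimage_ι_comp₂ i j) (P3.coord j k) =
      (chart i j).topIso.inv (ξ i j k) := by
  rw [appLE_comp_apply _ _ (chart_le₂ i j) (chart i j).ι_preimage_self.ge, opens_ι_appLE]
  rfl

lemma ι_comp_toSpecC (i j : Fin 4) : (chart i j).ι ≫ toSpecC =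
    (chart i j).toSpecΓ ≫ Spec.map (constMap i j) :=
  (toSpecΓ_comp_SpecMap _ _).symm

lemma chartToSpec_appTop (i j : Fin 4) (a : ChartRing i j) :
    (chartToSpec i j).appTop ((Scheme.ΓSpecIso (.of (ChartRing i j))).inv a) =
      (chart i j).topIso.inv (chartHom i j a) :=
  congrArg (fun φ => φ.hom a) (ΓSpecIso_inv_comp_appTop (chartMap i j))

lemma chartToSpec_comp_C (i j : Fin 4) : chartToSpec i j ≫
    Spec.map (CommRingCat.ofHom (MvPolynomial.C : ℂ →+* ChartRing i j)) =
      (chart i j).ι ≫ toSpecC := by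
  rw [ι_comp_toSpecC, chartToSpec, Category.assoc, ← Spec.map_comp]
  congr 2
  ext a
  exact chartHom_C i j a

lemma chartToSpec_comp_pt (i j l : Fin 4) (v : Fin 4 → ChartRing i j) (hv : v l = 1)
    {g : (chart i j).toScheme ⟶ P3} (hg : ⊤ ≤ g ⁻¹ᵁ P3.chart l)
    (hgC : g ≫ P3.toSpecC = (chart i j).ι ≫ toSpecC)
    (h : ∀ k, g.appLE (P3.chart l) ⊤ hg (P3.coord l k) =
      (chart i j).topIso.inv (chartHom i j (v k))) :
    chartToSpec i j ≫ P3.pt MvPolynomial.C v l hv = g := by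
  have h' : ⊤ ≤ (chartToSpec i j ≫ P3.pt MvPolynomial.C v l hv) ⁻¹ᵁ P3.chart l :=
    fun p _ => P3.le_preimage_pt MvPolynomial.C v l hv (Opens.mem_top _)
  refine P3.hom_ext h' hg ?_ fun k => ?_
  · rw [Category.assoc, P3.pt_toSpecC, hgC, chartToSpec_comp_C]
  · rw [h, appLE_comp_apply _ _ (P3.le_preimage_pt MvPolynomial.C v l hv) le_top, P3.pt_coord,
      appLE_top, chartToSpec_appTop]

variable {i j : Fin 4}

/-- The charts of the incidence variety are affine spaces. -/
lemma isIso_chartToSpec (hij : i ≠ j) : IsIso (chartToSpec i j) := by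
  -- The tautological point with coordinates $y$, $z$ over the chart ring gives the inverse
  -- morphism.
  obtain ⟨f, hf₁, hf₂⟩ := exists_pt MvPolynomial.C (ChartRing.y i j) (ChartRing.z i j) i j
    ChartRing.y_self (ChartRing.z_self hij) (ChartRing.sum_y_mul_z i j)
  have hft : ∀ p, f p ∈ chart i j := fun p => by
    constructor
    · change (f ≫ p₁) p ∈ P3.chart i
      rw [hf₁]
      exact P3.le_preimage_pt _ _ _ _ (Opens.mem_top p)
    · change (f ≫ p₂) p ∈ P3.chart j
      rw [hf₂]
      exact P3.le_preimage_pt _ _ _ _ (Opens.mem_top p)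
  let f' : Spec (.of (ChartRing i j)) ⟶ (chart i j).toScheme :=
    IsOpenImmersion.lift (chart i j).ι f (by
      rintro _ ⟨p, rfl⟩
      rw [Scheme.Opens.range_ι]
      exact hft p)
  have hf' : f' ≫ (chart i j).ι = f := IsOpenImmersion.lift_fac _ _ _
  have h1 : chartToSpec i j ≫ f = (chart i j).ι := by
    apply Inc.hom_ext
    · rw [Category.assoc, hf₁]
      refine chartToSpec_comp_pt i j i _ _ (le_preimage_ι_comp₁ i j) rfl fun k => ?_
      rw [ι_comp_p₁_coord, chartHom_y]
    · rw [Category.assoc, hf₂]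
      refine chartToSpec_comp_pt i j j _ _ (le_preimage_ι_comp₂ i j) ?_ fun k => ?_
      · rw [Category.assoc, p₂_toSpecC]
      · rw [ι_comp_p₂_coord, chartHom_z]
  -- A morphism to affine space is determined by its effect on constants and on the coordinates $y$,
  -- $z$.
  have h2 : f' ≫ chartToSpec i j = 𝟙 _ := by
    apply ext_of_isAffine
    rw [← cancel_epi (Scheme.ΓSpecIso _).inv]
    apply CommRingCat.hom_ext
    have e : ∀ a, f'.appTop ((chartToSpec i j).appTop
        ((Scheme.ΓSpecIso (.of (ChartRing i j))).inv a)) =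
          f'.appTop ((chart i j).topIso.inv (chartHom i j a)) := fun a => by
      rw [chartToSpec_appTop]
    refine ChartRing.hom_ext (fun a => ?_) (fun k => ?_) fun k => ?_
    · have : f' ≫ chartToSpec i j ≫ Spec.map (CommRingCat.ofHom
          (MvPolynomial.C : ℂ →+* ChartRing i j)) =
          Spec.map (CommRingCat.ofHom (MvPolynomial.C : ℂ →+* ChartRing i j)) := by
        rw [chartToSpec_comp_C, ← Category.assoc, hf', toSpecC, ← Category.assoc, hf₁,
          P3.pt_toSpecC]
      have := congrArg (fun φ => (Scheme.ΓSpecIso (.of ℂ)).inv ≫ Scheme.Hom.appTop φ) this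
      rw [← Category.assoc, Scheme.Hom.comp_appTop (f' ≫ chartToSpec i j),
        ← Scheme.ΓSpecIso_inv_naturality_assoc, ← Scheme.ΓSpecIso_inv_naturality] at this
      exact congrArg (fun φ => φ.hom a) this
    · refine (e _).trans ?_
      have hle : ⊤ ≤ (f' ≫ (chart i j).ι ≫ p₁) ⁻¹ᵁ P3.chart i := by
        rw [← Category.assoc, hf', hf₁]
        exact P3.le_preimage_pt _ _ _ _
      have hcomp : f' ≫ (chart i j).ι ≫ p₁ = _ :=
        (Category.assoc _ _ _).symm.trans ((congrArg (· ≫ p₁) hf').trans hf₁)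
      rw [chartHom_y, ← ι_comp_p₁_coord, appTop_appLE_apply f' _ _ hle,
        appLE_congr_hom hcomp hle (P3.le_preimage_pt _ _ _ _), P3.pt_coord]
      rfl
    · refine (e _).trans ?_
      have hle : ⊤ ≤ (f' ≫ (chart i j).ι ≫ p₂) ⁻¹ᵁ P3.chart j := by
        rw [← Category.assoc, hf', hf₂]
        exact P3.le_preimage_pt _ _ _ _
      have hcomp : f' ≫ (chart i j).ι ≫ p₂ = _ :=
        (Category.assoc _ _ _).symm.trans ((congrArg (· ≫ p₂) hf').trans hf₂)
      rw [chartHom_z, ← ι_comp_p₂_coord, appTop_appLE_apply f' _ _ hle,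
        appLE_congr_hom hcomp hle (P3.le_preimage_pt _ _ _ _), P3.pt_coord]
      rfl
  refine ⟨f', ?_, h2⟩
  rw [← cancel_mono (chart i j).ι, Category.assoc, hf', h1, Category.id_comp]

lemma isAffineOpen_chart (hij : i ≠ j) : IsAffineOpen (chart i j) :=
  have := isIso_chartToSpec hij
  .of_isIso (chartToSpec i j)

lemma chartHom_bijective (hij : i ≠ j) : Function.Bijective (chartHom i j) := by
  have := isIso_chartToSpec hij
  have h : chartMap i j =
      (Scheme.ΓSpecIso _).inv ≫ (chartToSpec i j).appTop ≫ (chart i j).topIso.hom := by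
    rw [← Category.assoc, chartToSpec, ΓSpecIso_inv_comp_appTop, Category.assoc, Iso.inv_hom_id,
      Category.comp_id]
  have h' : IsIso (chartToSpec i j).appTop := inferInstanceAs (IsIso ((chartToSpec i j).app ⊤))
  have : IsIso (chartMap i j) := h ▸ IsIso.comp_isIso' inferInstance
    (IsIso.comp_isIso' h' inferInstance)
  exact ConcreteCategory.bijective_of_isIso (chartMap i j)

/-- The coordinate ring of a chart. -/
def chartEquiv (hij : i ≠ j) : ChartRing i j ≃+* Γ(Inc, chart i j) :=
  RingEquiv.ofBijective (chartHom i j) (chartHom_bijective hij)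

end Inc

lemma toK_appLE {X Y : Scheme.{u}} [IsIntegral X] (f : X ⟶ Y) {U : Y.Opens} {V W : X.Opens}
    (h : V ≤ f ⁻¹ᵁ U) (h' : W ≤ f ⁻¹ᵁ U) (hV : genericPoint X ∈ V) (hW : genericPoint X ∈ W)
    (a : Γ(Y, U)) : toK V hV (f.appLE U V h a) = toK W hW (f.appLE U W h' a) := by
  have r : ∀ {V : X.Opens} (h : V ≤ f ⁻¹ᵁ U) (hV : genericPoint X ∈ V),
      toK V hV (f.appLE U V h a) = toK (f ⁻¹ᵁ U) (h hV) (f.appLE U _ le_rfl a) := fun h hV => by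
    rw [← toK_res h hV, resFun_appLE]
  rw [r h hV, r h' hW]

/-! ### Integrality of the incidence variety and its coordinate rational functions -/

namespace Inc

section

variable {i j : Fin 4} (hij : i ≠ j)

include hij

lemma isDomain_chart : IsDomain Γ(Inc, chart i j) :=
  (chartEquiv hij).symm.toMulEquiv.isDomain _

lemma uniqueFactorizationMonoid_chart : UniqueFactorizationMonoid Γ(Inc, chart i j) :=
  (chartEquiv hij).toMulEquiv.uniqueFactorizationMonoid inferInstance

lemma x_ne_zero (k : Fin 4) : x i j k ≠ 0 := by
  rw [← chartHom_y]
  exact (map_ne_zero_iff _ (chartHom_bijective hij).1).mpr (ChartRing.y_ne_zero k)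

lemma ξ_ne_zero (k : Fin 4) : ξ i j k ≠ 0 := by
  rw [← chartHom_z]
  exact (map_ne_zero_iff _ (chartHom_bijective hij).1).mpr (ChartRing.z_ne_zero hij k)

/-- Inside the chart $(i,j)$ the intersection is the nonvanishing locus of $x_k\xi_l$, a nonzero
element of a domain. -/
lemma chart_inf_chart_nonempty (k l : Fin 4) :
    ((chart i j ⊓ chart k l : Inc.Opens) : Set Inc).Nonempty := by
  have := isDomain_chart hij
  rw [← basicOpen_x_mul_ξ, Set.nonempty_iff_ne_empty]
  intro h
  have h' : Inc.basicOpen (x i j k * ξ i j l) = ⊥ := Opens.ext h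
  rw [basicOpen_eq_bot_iff] at h'
  exact mul_ne_zero (x_ne_zero hij k) (ξ_ne_zero hij l) h'

lemma nonempty_chart : Nonempty (chart i j) :=
  (chart_inf_chart_nonempty hij i j).elim fun p hp => ⟨⟨p, hp.1⟩⟩

lemma isPreirreducible_chart : IsPreirreducible (chart i j : Set Inc) := by
  have := isIso_chartToSpec hij
  have : Nonempty (chart i j).toScheme := nonempty_chart hij
  have : IsIntegral (Spec (.of (ChartRing i j))) := by
    have : IsDomain (CommRingCat.of (ChartRing i j)) := inferInstanceAs (IsDomain (ChartRing i j))
    infer_instance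
  have : IsIntegral (chart i j).toScheme := isIntegral_of_isOpenImmersion (chartToSpec i j)
  have h := ((inferInstance : PreirreducibleSpace (chart i j).toScheme).isPreirreducible_univ).image
    (chart i j).ι (chart i j).ι.continuous.continuousOn
  rwa [Set.image_univ, Scheme.Opens.range_ι] at h

end

/-- The irreducible charts cover $I$ and all meet the chart $(0,3)$, so every nonempty open set
meets that chart. -/
instance : IrreducibleSpace Inc := by
  have h03 : (0 : Fin 4) ≠ 3 := by decide
  have key : ∀ V : Set Inc, IsOpen V → V.Nonempty → ((chart 0 3 : Set Inc) ∩ V).Nonempty := by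
    rintro V hV ⟨p, hp⟩
    obtain ⟨i, j, hij, hp'⟩ := exists_mem_chart p
    obtain ⟨q, -, hq, hq'⟩ := isPreirreducible_chart hij V (chart 0 3) hV (chart 0 3).2
      ⟨p, hp', hp⟩ (chart_inf_chart_nonempty hij 0 3)
    exact ⟨q, hq', hq⟩
  refine { isPreirreducible_univ := fun V W hV hW hV' hW' => ?_, toNonempty := ?_ }
  · rw [Set.univ_inter] at hV' hW' ⊢
    exact (isPreirreducible_chart h03 V W hV hW (key V hV hV') (key W hW hW')).mono
      Set.inter_subset_right
  · exact (nonempty_chart h03).map Subtype.val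

instance : IsIntegral Inc := isIntegral_of_irreducibleSpace_of_isReduced _

lemma genericPoint_mem_chart {i j : Fin 4} (hij : i ≠ j) : genericPoint Inc ∈ chart i j :=
  genericPoint_mem (nonempty_chart hij).some.2

lemma genericPoint_mem₁ (i : Fin 4) : genericPoint Inc ∈ p₁ ⁻¹ᵁ P3.chart i := by
  obtain ⟨j, hj⟩ := exists_ne i
  exact (genericPoint_mem_chart hj.symm).1

lemma genericPoint_mem₂ (j : Fin 4) : genericPoint Inc ∈ p₂ ⁻¹ᵁ P3.chart j := by
  obtain ⟨i, hi⟩ := exists_ne j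
  exact (genericPoint_mem_chart hi).2

/-- The rational function `x_k / x_i`. -/
def xK (i k : Fin 4) : Inc.functionFieldˣ :=
  (O1.pullback p₁).gen i k (genericPoint_mem₁ i) (genericPoint_mem₁ k)

/-- The rational function `ξ_k / ξ_j`. -/
def ξK (j k : Fin 4) : Inc.functionFieldˣ :=
  (O1.pullback p₂).gen j k (genericPoint_mem₂ j) (genericPoint_mem₂ k)

lemma xK_mul (i j k : Fin 4) : xK i j * xK j k = xK i k := (O1.pullback p₁).gen_mul i j k _ _ _

lemma ξK_mul (i j k : Fin 4) : ξK i j * ξK j k = ξK i k := (O1.pullback p₂).gen_mul i j k _ _ _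

lemma toK_x {i j : Fin 4} (h : genericPoint Inc ∈ chart i j) (k : Fin 4) :
    toK (chart i j) h (x i j k) = xK i k := by
  have e : (p₁.appLE (P3.chart i ⊓ P3.chart k) (p₁ ⁻¹ᵁ P3.chart i ⊓ p₁ ⁻¹ᵁ P3.chart k)
      (le_preimage_inf p₁ inf_le_left inf_le_right)) (resFun inf_le_left (P3.coord i k)) =
      p₁.appLE (P3.chart i) _ inf_le_left (P3.coord i k) := appLE_resFun _ _ _ _
  refine (toK_appLE p₁ _ inf_le_left h ⟨genericPoint_mem₁ i, genericPoint_mem₁ k⟩ _).trans ?_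
  exact (congrArg (toK _ _) e).symm

lemma toK_ξ {i j : Fin 4} (h : genericPoint Inc ∈ chart i j) (k : Fin 4) :
    toK (chart i j) h (ξ i j k) = ξK j k := by
  have e : (p₂.appLE (P3.chart j ⊓ P3.chart k) (p₂ ⁻¹ᵁ P3.chart j ⊓ p₂ ⁻¹ᵁ P3.chart k)
      (le_preimage_inf p₂ inf_le_left inf_le_right)) (resFun inf_le_left (P3.coord j k)) =
      p₂.appLE (P3.chart j) _ inf_le_left (P3.coord j k) := appLE_resFun _ _ _ _
  refine (toK_appLE p₂ _ inf_le_left h ⟨genericPoint_mem₂ j, genericPoint_mem₂ k⟩ _).trans ?_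
  exact (congrArg (toK _ _) e).symm

lemma xK_mem {p : Inc} {i k : Fin 4} (hi : p₁ p ∈ P3.chart i) (hk : p₁ p ∈ P3.chart k) :
    xK i k ∈ unitsAt p :=
  (O1.pullback p₁).gen_mem i k hi hk

lemma ξK_mem {p : Inc} {j k : Fin 4} (hj : p₂ p ∈ P3.chart j) (hk : p₂ p ∈ P3.chart k) :
    ξK j k ∈ unitsAt p :=
  (O1.pullback p₂).gen_mem j k hj hk

lemma isLocalEq_H₁ (k : Fin 4) (i : Inc → Fin 4) (hi : ∀ p, p₁ p ∈ P3.chart (i p)) :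
    IsLocalEq H₁ fun p => xK (i p) k :=
  (O1.pullback p₁).isLocalEq_gen k (genericPoint_mem₁ k) i hi

lemma isLocalEq_H₂ (k : Fin 4) (j : Inc → Fin 4) (hj : ∀ p, p₂ p ∈ P3.chart (j p)) :
    IsLocalEq H₂ fun p => ξK (j p) k :=
  (O1.pullback p₂).isLocalEq_gen k (genericPoint_mem₂ k) j hj

end Inc

/-! ### Germs of principal divisors, which turn membership in `unitsAt` into equations in a group -/

section DivAt

variable {X : Scheme.{u}} [IsIntegral X]

/-- The group of germs of principal Cartier divisors at a point. -/
def DivAt (x : X) : Type u := X.functionFieldˣ ⧸ unitsAt x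

instance (x : X) : CommGroup (DivAt x) := inferInstanceAs (CommGroup (_ ⧸ unitsAt x))

/-- The divisor of a rational function, at a point. -/
def divAt (x : X) : X.functionFieldˣ →* DivAt x := QuotientGroup.mk' (unitsAt x)

lemma divAt_eq_one {x : X} {f : X.functionFieldˣ} : divAt x f = 1 ↔ f ∈ unitsAt x :=
  QuotientGroup.eq_one_iff f

end DivAt

/-! ### Generation of the Picard group by the two hyperplane classes -/

namespace Inc

section

variable {i j : Fin 4}

lemma prime_x (hij : i ≠ j) {k : Fin 4} (h : k ≠ i) : Prime (x i j k) := by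
  rw [← chartHom_y]
  exact (MulEquiv.prime_iff (chartEquiv hij).toMulEquiv).mpr (ChartRing.prime_y h)

lemma prime_ξ (hij : i ≠ j) {k : Fin 4} (h : k ≠ j) : Prime (ξ i j k) := by
  rw [← chartHom_z]
  exact (MulEquiv.prime_iff (chartEquiv hij).toMulEquiv).mpr (ChartRing.prime_z hij h)

lemma isRelPrime_x_mul_ξ (hij : i ≠ j) {a a' b b' : Fin 4} (ha : a ≠ a') (hb : b ≠ b') :
    IsRelPrime (x i j a * ξ i j b) (x i j a' * ξ i j b') := by
  intro d h h'
  obtain ⟨d, rfl⟩ := (chartHom_bijective hij).2 d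
  have e : ∀ {r s}, chartHom i j r ∣ chartHom i j s ↔ r ∣ s := fun {r s} =>
    map_dvd_iff (chartEquiv hij)
  rw [← chartHom_y, ← chartHom_z, ← map_mul, e] at h h'
  exact (ChartRing.isRelPrime_mul hij ha hb h h').map _

lemma const_mem_regAt (h : genericPoint Inc ∈ chart i j) (c : ℂ) (p : Inc) :
    toK (chart i j) h (const i j c) ∈ regAt p := by
  have e : toK (chart i j) h (const i j c) = toK ⊤ (Opens.mem_top _)
      (toSpecC.appLE ⊤ ⊤ (le_preimage_top _ _) ((Scheme.ΓSpecIso (.of ℂ)).inv c)) :=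
    toK_appLE _ _ _ _ _ _
  rw [e]
  exact toK_mem_regAt (Opens.mem_top p) _

/-- Units of a polynomial ring over a field are constants, and constants are pulled back from the
base, hence regular everywhere. -/
lemma toK_mem_regAt_of_isUnit (hij : i ≠ j) (h : genericPoint Inc ∈ chart i j)
    {w : Γ(Inc, chart i j)} (hw : IsUnit w) (p : Inc) : toK (chart i j) h w ∈ regAt p := by
  obtain ⟨w, rfl⟩ := (chartHom_bijective hij).2 w
  have hw' : IsUnit w := (MulEquiv.isUnit_map (chartEquiv hij)).mp hw
  obtain ⟨c, rfl⟩ := ChartRing.exists_eq_C_of_isUnit hw'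
  rw [chartHom_C]
  exact const_mem_regAt h c p

/-- The invertible functions on a chart are constant, hence extend to the incidence variety. -/
lemma unitK_mem_unitsAt_of_chart (hij : i ≠ j) (h : genericPoint Inc ∈ chart i j)
    (w : Γ(Inc, chart i j)ˣ) (p : Inc) : unitK (chart i j) h w ∈ unitsAt p := by
  rw [mem_unitsAt, ← map_inv]
  exact ⟨toK_mem_regAt_of_isUnit hij h w.isUnit p, toK_mem_regAt_of_isUnit hij h w⁻¹.isUnit p⟩

lemma denPow_of_mem (hij : i ≠ j) (k l : Fin 4) {f : Inc.functionField}
    [Nonempty (chart i j)]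
    (hf : ∀ p ∈ chart i j ⊓ chart k l, f ∈ regAt p) :
    DenPow Γ(Inc, chart i j) (x i j k * ξ i j l) f := by
  have := isDomain_chart hij
  refine denPow_of_forall (isAffineOpen_chart hij)
    (mul_ne_zero (x_ne_zero hij k) (ξ_ne_zero hij l)) fun p hp => ?_
  rw [basicOpen_x_mul_ξ] at hp
  exact hf p hp

/-- A rational function without zeros and poles on the charts `x_a ξ_b ≠ 0` and `x_a' ξ_b' ≠ 0`
has none on any other chart, if `a ≠ a'` and `b ≠ b'`. -/
lemma mem_unitsAt_of_mem (hij : i ≠ j) {a a' b b' : Fin 4} (ha : a ≠ a') (hb : b ≠ b')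
    {f : Inc.functionFieldˣ} (h : ∀ p ∈ chart i j ⊓ chart a b, f ∈ unitsAt p)
    (h' : ∀ p ∈ chart i j ⊓ chart a' b', f ∈ unitsAt p) {p : Inc} (hp : p ∈ chart i j) :
    f ∈ unitsAt p := by
  have := isDomain_chart hij
  have := uniqueFactorizationMonoid_chart hij
  have : Nonempty (chart i j) := ⟨⟨p, hp⟩⟩
  have := functionField_isFractionRing_of_isAffineOpen Inc (chart i j) (isAffineOpen_chart hij)
  -- The Hartogs argument `mem_range_of_denPow` for regularity; it is used for both $f$ and
  -- $f^{-1}$.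
  have key : ∀ g : Inc.functionField, (∀ p ∈ chart i j ⊓ chart a b, g ∈ regAt p) →
      (∀ p ∈ chart i j ⊓ chart a' b', g ∈ regAt p) → g ∈ regAt p := fun g hg hg' => by
    obtain ⟨r, rfl⟩ := mem_range_of_denPow (mul_ne_zero (x_ne_zero hij a) (ξ_ne_zero hij b))
      (isRelPrime_x_mul_ξ hij ha hb) (denPow_of_mem hij a b hg) (denPow_of_mem hij a' b' hg')
    exact toK_mem_regAt hp r
  rw [mem_unitsAt]
  exact ⟨key _ (fun p hp => (mem_unitsAt.mp (h p hp)).1) fun p hp => (mem_unitsAt.mp (h' p hp)).1,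
    key _ (fun p hp => (mem_unitsAt.mp (h p hp)).2) fun p hp => (mem_unitsAt.mp (h' p hp)).2⟩

/-- A rational function without zeros and poles on the intersection of two charts is a monomial in
the coordinates, up to a constant. -/
lemma exists_zpow_of_mem (hij : i ≠ j) {k l : Fin 4} (hk : k ≠ i) (hl : l ≠ j)
    {f : Inc.functionFieldˣ} (h : ∀ p ∈ chart i j ⊓ chart k l, f ∈ unitsAt p) :
    ∃ (w : Inc.functionFieldˣ) (a b : ℤ), (∀ p, w ∈ unitsAt p) ∧
      f = w * xK i k ^ a * ξK j l ^ b := by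
  have := isDomain_chart hij
  have := uniqueFactorizationMonoid_chart hij
  have := nonempty_chart hij
  have := functionField_isFractionRing_of_isAffineOpen Inc (chart i j) (isAffineOpen_chart hij)
  obtain ⟨w, a, b, hf⟩ := exists_unit_mul_zpow (prime_x hij hk) (prime_ξ hij hl) f.ne_zero
    (denPow_of_mem hij k l fun p hp => (mem_unitsAt.mp (h p hp)).1)
    (by
      rw [← Units.val_inv_eq_inv_val]
      exact denPow_of_mem hij k l fun p hp => (mem_unitsAt.mp (h p hp)).2)
  have hη := genericPoint_mem_chart hij
  refine ⟨unitK _ hη w, a, b, unitK_mem_unitsAt_of_chart hij hη w, Units.ext ?_⟩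
  rw [hf, Units.val_mul, Units.val_mul, Units.val_zpow_eq_zpow_val, Units.val_zpow_eq_zpow_val,
    ← toK_x hη, ← toK_ξ hη]
  rfl

end

/-- The Picard group of the incidence variety is generated by `H₁` and `H₂`. -/
theorem exists_eq_zpow (p : Pic Inc) : ∃ a b : ℤ, p = H₁ ^ a * H₂ ^ b := by
  obtain ⟨D, hD⟩ := exists_isLocalEq p
  have h03 : (0 : Fin 4) ≠ 3 := by decide
  have hc : ∀ i j : Fin 4, i ≠ j → ∃ h : Inc.functionFieldˣ, ∀ x ∈ chart i j,
      D x / h ∈ unitsAt x := fun i j hij => by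
    have := nonempty_chart hij
    have := uniqueFactorizationMonoid_chart hij
    exact hD.exists_const (isAffineOpen_chart hij)
  choose! h hh using hc
  choose i j hij hx using exists_mem_chart
  have hq : ∀ {x f}, f ∈ unitsAt x ↔ divAt (X := Inc) x f = 1 := divAt_eq_one.symm
  have hqD : ∀ {k l x}, k ≠ l → x ∈ chart k l → divAt x (D x) = divAt x (h k l) := fun hkl hx => by
    have := hh _ _ hkl _ hx
    rwa [hq, map_div, div_eq_one] at this
  -- Both constant local equations generate the bundle on the overlap of the charts $(0,3)$ and
  -- $(3,0)$, so their ratio is a constant times $(x_3/x_0)^a(\xi_0/\xi_3)^b$.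
  obtain ⟨w, a, b, hw, hf⟩ := exists_zpow_of_mem (f := h 3 0 / h 0 3) h03 (k := 3) (l := 0)
    h03.symm h03 (fun x hx => by
      rw [hq, map_div, ← hqD h03 hx.1, ← hqD h03.symm hx.2, div_self'])
  have hqx : ∀ {k l m n x}, x ∈ chart k l → x ∈ chart m n → divAt x (xK k m) = 1 := fun hx hx' =>
    hq.mp (xK_mem hx.1 hx'.1)
  have hqξ : ∀ {k l m n x}, x ∈ chart k l → x ∈ chart m n → divAt x (ξK l n) = 1 := fun hx hx' =>
    hq.mp (ξK_mem hx.2 hx'.2)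
  refine ⟨-a, -b, hD.eq (((isLocalEq_H₁ 0 i fun x => (hx x).1).zpow (-a)).mul
    ((isLocalEq_H₂ 3 j fun x => (hx x).2).zpow (-b))) (h 0 3)⁻¹ fun x => ?_⟩
  -- The comparison of the twisted bundle with the trivialization `h 0 3`. On the chart $(0,3)$ all
  -- coordinate ratios are units. On the chart $(3,0)$ the monomial in `hf` cancels against the
  -- twist, since there $x_0/x_i$ is a unit times $(x_3/x_0)^{-1}$, and similarly for $\xi$.
  let g := h (i x) (j x) * (h 0 3)⁻¹ * xK (i x) 0 ^ a * ξK (j x) 3 ^ b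
  have hg : g ∈ unitsAt x := by
    refine mem_unitsAt_of_mem (hij x) h03 h03.symm (fun y hy => ?_) (fun y hy => ?_) (hx x)
    · rw [hq]
      simp only [g, map_mul, map_zpow, map_inv]
      rw [← hqD h03 hy.2, ← hqD (hij x) hy.1, hqx hy.1 hy.2, hqξ hy.1 hy.2]
      simp
    · rw [hq]
      have e := congrArg (divAt y) hf
      rw [map_mul, map_mul, map_div, hq.mp (hw y), map_zpow, map_zpow, one_mul,
        ← hqD h03.symm hy.2, hqD (hij x) hy.1, div_eq_mul_inv] at e
      have e₁ := hqx hy.1 hy.2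
      have e₂ := hqξ hy.1 hy.2
      rw [← xK_mul (i x) 0 3, map_mul, mul_eq_one_iff_eq_inv] at e₁
      rw [← ξK_mul (j x) 3 0, map_mul, mul_eq_one_iff_eq_inv] at e₂
      simp only [g, map_mul, map_zpow, map_inv]
      rw [e, e₁, e₂, inv_zpow, inv_zpow]
      simp
  rw [hq] at hg ⊢
  simp only [g, map_mul, map_zpow, map_inv] at hg
  simp only [map_div, map_mul, map_inv, Pi.mul_apply, Pi.inv_apply, Pi.pow_apply, map_zpow, zpow_neg,
    hqD (hij x) (hx x)]
  rw [← hg]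
  simp only [div_eq_mul_inv, mul_inv, inv_inv]
  ac_rfl

end Inc

/-! ### Globally generated line bundles -/

/-- A line bundle is globally generated if each point has a section that does not vanish there. -/
def LineBundle.IsGloballyGenerated {X : Scheme.{u}} (L : LineBundle X) : Prop :=
  ∀ x : X, ∃ s : ∀ i, Γ(X, L.U i),
    (∀ i j, resFun inf_le_left (s i) = (L.g i j : Γ(X, L.U i ⊓ L.U j)) * resFun inf_le_right (s j)) ∧
    ∃ i, x ∈ X.basicOpen (s i)

lemma LineBundle.IsGloballyGenerated.pullback {X Y : Scheme.{u}} {L : LineBundle Y}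
    (h : L.IsGloballyGenerated) (f : X ⟶ Y) : (L.pullback f).IsGloballyGenerated := by
  intro x
  obtain ⟨s, hs, i, hi⟩ := h (f x)
  refine ⟨fun i => f.appLE (L.U i) (f ⁻¹ᵁ L.U i) le_rfl (s i), fun j k => ?_, i, ?_⟩
  · have := congrArg (f.appLE (L.U j ⊓ L.U k) (f ⁻¹ᵁ L.U j ⊓ f ⁻¹ᵁ L.U k)
      (le_preimage_inf f inf_le_left inf_le_right)) (hs j k)
    rw [map_mul, appLE_resFun, appLE_resFun] at this
    rw [resFun_appLE, resFun_appLE]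
    exact this
  · rw [Scheme.basicOpen_appLE]
    exact ⟨Y.basicOpen_le _ hi, hi⟩

/-- The classes of globally generated line bundles. -/
def IsGloballyGenerated {X : Scheme.{u}} (p : Pic X) : Prop :=
  ∃ L, Pic.mk L = p ∧ L.IsGloballyGenerated

lemma IsGloballyGenerated.pullback {X Y : Scheme.{u}} {p : Pic Y} (h : IsGloballyGenerated p)
    (f : X ⟶ Y) : IsGloballyGenerated (Pic.pullback f p) := by
  obtain ⟨L, rfl, hL⟩ := h
  exact ⟨L.pullback f, rfl, hL.pullback f⟩

lemma IsGloballyGenerated.one (X : Scheme.{u}) : IsGloballyGenerated (1 : Pic X) := by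
  refine ⟨LineBundle.trivial X, rfl, fun x => ⟨fun _ => 1, fun _ _ => ?_, ⟨⟩, ?_⟩⟩
  · exact (map_one _).trans ((one_mul _).trans (map_one _)).symm
  · rw [Scheme.basicOpen_of_isUnit _ isUnit_one]
    trivial

lemma isGloballyGenerated_O1 : O1.IsGloballyGenerated := by
  intro x
  obtain ⟨k, hk⟩ := P3.chart_cover x
  refine ⟨fun i => P3.coord i k, fun i j => (P3.coord_mul i j k _ _ _).symm, k, ?_⟩
  have h : P3.basicOpen (P3.coord k k) = P3.chart k := by
    rw [P3.coord_self, Scheme.basicOpen_of_isUnit _ isUnit_one]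
  exact h.ge hk

lemma isGloballyGenerated_H₁ : IsGloballyGenerated H₁ :=
  ⟨_, rfl, isGloballyGenerated_O1.pullback Inc.p₁⟩

lemma isGloballyGenerated_H₂ : IsGloballyGenerated H₂ :=
  ⟨_, rfl, isGloballyGenerated_O1.pullback Inc.p₂⟩

lemma mem_unitsAt_of_mem_basicOpen {X : Scheme.{u}} [IsIntegral X] {U : X.Opens} {x : X}
    (hU : genericPoint X ∈ U) {a : Γ(X, U)} (hx : x ∈ X.basicOpen a) {f : X.functionFieldˣ}
    (hf : f = toK U hU a) : f ∈ unitsAt x := by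
  obtain ⟨v, hv⟩ := RingedSpace.isUnit_res_basicOpen X.toRingedSpace a
  have e : f = unitK (X.basicOpen a) (genericPoint_mem hx) v := Units.ext <| by
    rw [hf, ← toK_res (X.basicOpen_le a) (genericPoint_mem hx)]
    exact congrArg _ hv.symm
  rw [e]
  exact unitK_mem_unitsAt hx v

/-- A global section not vanishing at $x_0$, read in a rational trivialization: $fD$ is its
coordinate with respect to the local generators. -/
lemma IsGloballyGenerated.exists_mul_mem {X : Scheme.{u}} [IsIntegral X] {p : Pic X}
    (h : IsGloballyGenerated p) {D : X → X.functionFieldˣ} (hD : IsLocalEq p D) (x₀ : X) :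
    ∃ f : X.functionFieldˣ, (∀ x, ((f * D x : X.functionFieldˣ) : X.functionField) ∈ regAt x) ∧
      f * D x₀ ∈ unitsAt x₀ := by
  obtain ⟨L, hL, hgg⟩ := h
  obtain ⟨s, hs, k, hk⟩ := hgg x₀
  have hk₀ : x₀ ∈ L.U k := X.basicOpen_le _ hk
  have hη := genericPoint_mem hk₀
  obtain ⟨h, hh⟩ := hD.exists_gen hL k hη
  have ht : toK (L.U k) hη (s k) ≠ 0 := by
    rw [← toK_res (X.basicOpen_le (s k)) (genericPoint_mem hk)]
    exact ((RingedSpace.isUnit_res_basicOpen X.toRingedSpace (s k)).map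
      (toK _ (genericPoint_mem hk))).ne_zero
  let t : X.functionFieldˣ := Units.mk0 _ ht
  have e : ∀ x i (hi : x ∈ L.U i), t * h⁻¹ * D x =
      (L.gen i k (genericPoint_mem hi) hη * t) *
        (h * L.gen i k (genericPoint_mem hi) hη / D x)⁻¹ := fun x i hi => by
    rw [inv_div, div_eq_mul_inv, mul_inv]
    generalize L.gen i k _ _ = g
    calc _ = t * h⁻¹ * D x * (g * g⁻¹) := by simp
      _ = _ := by ac_rfl
  refine ⟨t * h⁻¹, fun x => ?_, ?_⟩
  · obtain ⟨i, hi⟩ := L.cover x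
    rw [e x i hi, Units.val_mul]
    refine mul_mem ?_ (mem_unitsAt.mp (hh x i hi)).2
    have hη' : genericPoint X ∈ L.U i ⊓ L.U k := ⟨genericPoint_mem hi, hη⟩
    have := congrArg (toK (L.U i ⊓ L.U k) hη') (hs i k)
    rw [map_mul, toK_res, toK_res] at this
    have e' : ((L.gen i k (genericPoint_mem hi) hη * t : X.functionFieldˣ) : X.functionField) =
      toK (L.U i) (genericPoint_mem hi) (s i) := this.symm
    rw [e']
    exact toK_mem_regAt hi _
  · rw [e x₀ k hk₀]
    refine mul_mem (mul_mem (L.gen_mem k k hk₀ hk₀) ?_) (inv_mem (hh x₀ k hk₀))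
    exact mem_unitsAt_of_mem_basicOpen hη hk rfl

namespace Inc

lemma exists_mul_mem {a b : ℤ} (h : IsGloballyGenerated (H₁ ^ a * H₂ ^ b)) (p₀ : Inc) :
    ∃ f : Inc.functionFieldˣ,
      (∀ i j, ∀ p ∈ chart i j,
        ((f * (xK i 0 ^ a * ξK j 3 ^ b) : Inc.functionFieldˣ) : Inc.functionField) ∈ regAt p) ∧
      ∀ i j, p₀ ∈ chart i j → f * (xK i 0 ^ a * ξK j 3 ^ b) ∈ unitsAt p₀ := by
  choose i j hij hp using exists_mem_chart
  obtain ⟨f, hf, hf₀⟩ := h.exists_mul_mem (((isLocalEq_H₁ 0 i fun p => (hp p).1).zpow a).mul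
    ((isLocalEq_H₂ 3 j fun p => (hp p).2).zpow b)) p₀
  have e : ∀ k l p, p ∈ chart k l → ∃ u ∈ unitsAt p, f * (xK k 0 ^ a * ξK l 3 ^ b) =
      f * (xK (i p) 0 ^ a * ξK (j p) 3 ^ b) * u := fun k l p h => by
    refine ⟨xK k (i p) ^ a * ξK l (j p) ^ b, mul_mem (zpow_mem (xK_mem h.1 (hp p).1) a)
      (zpow_mem (ξK_mem h.2 (hp p).2) b), ?_⟩
    rw [← xK_mul k (i p) 0, ← ξK_mul l (j p) 3, mul_zpow, mul_zpow]
    ac_rfl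
  refine ⟨f, fun k l p h => ?_, fun k l h => ?_⟩
  · obtain ⟨u, hu, e⟩ := e k l p h
    rw [e, Units.val_mul]
    exact mul_mem (hf p) (mem_unitsAt.mp hu).1
  · obtain ⟨u, hu, e⟩ := e k l p₀ h
    rw [e]
    exact mul_mem hf₀ hu

end Inc

/-! ### Lines on the incidence variety -/

lemma ChartRing.map_lift {R S : Type*} [CommRing R] [CommRing S] (φ : R →+* S) (c : ℂ →+* R)
    (v w : Fin 4 → R) (i j : Fin 4) (p : ChartRing i j) :
    φ (lift c v w i j p) = lift (φ.comp c) (fun k => φ (v k)) (fun k => φ (w k)) i j p := by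
  have : φ.comp (lift c v w i j) = lift (φ.comp c) (fun k => φ (v k)) (fun k => φ (w k)) i j := by
    refine MvPolynomial.ringHom_ext (fun a => ?_) ?_
    · rw [RingHom.comp_apply, lift_C, lift_C, RingHom.comp_apply]
    · rintro (k | k) <;> simp [lift]
  exact congrArg (fun ψ => ψ p) this

namespace P3

lemma appLE_coord_mul {T : Scheme.{0}} (g : T ⟶ P3) {i k : Fin 4} (hi : ⊤ ≤ g ⁻¹ᵁ chart i)
    (hk : ⊤ ≤ g ⁻¹ᵁ chart k) (m : Fin 4) :
    g.appLE (chart i) ⊤ hi (coord i k) * g.appLE (chart k) ⊤ hk (coord k m) =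
      g.appLE (chart i) ⊤ hi (coord i m) := by
  have := congrArg (g.appLE (chart i ⊓ chart k) ⊤ (le_preimage_inf g hi hk))
    (coord_mul i k m _ inf_le_left inf_le_right)
  rwa [map_mul, appLE_resFun, appLE_resFun, appLE_resFun] at this

variable {R : Type} [CommRing R] (c : ℂ →+* R) (v : Fin 4 → R) (i : Fin 4) (hv : v i = 1)

lemma le_preimage_pt_of_isUnit {k : Fin 4} (hk : IsUnit (v k)) : ⊤ ≤ pt c v i hv ⁻¹ᵁ chart k := by
  have h : (Spec (.of R)).basicOpen ((pt c v i hv).appLE (chart i) ⊤ (le_preimage_pt c v i hv)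
      (coord i k)) = ⊤ := by
    rw [pt_coord]
    exact Scheme.basicOpen_of_isUnit _ (hk.map (Scheme.ΓSpecIso (.of R)).inv.hom)
  rw [Scheme.basicOpen_appLE, basicOpen_coord] at h
  exact fun p hp => (h.ge hp).2.2

/-- Passage to another chart: dividing the homogeneous coordinate vector by its unit entry $v_k$
does not change the point. -/
lemma pt_coord_of_mul_eq {k : Fin 4} (hk : IsUnit (v k)) {v' : Fin 4 → R}
    (h : ∀ m, v m = v k * v' m) (m : Fin 4) :
    (pt c v i hv).appLE (chart k) ⊤ (le_preimage_pt_of_isUnit c v i hv hk) (coord k m) =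
      (Scheme.ΓSpecIso (.of R)).inv (v' m) := by
  have := appLE_coord_mul (pt c v i hv) (le_preimage_pt c v i hv)
    (le_preimage_pt_of_isUnit c v i hv hk) m
  rw [pt_coord, pt_coord] at this
  refine (hk.map (Scheme.ΓSpecIso (.of R)).inv.hom).mul_left_cancel (this.trans ?_)
  rw [h m]
  exact map_mul (Scheme.ΓSpecIso (.of R)).inv.hom _ _

end P3

namespace Inc

section

variable {R : Type} [CommRing R] {c : ℂ →+* R} {v w : Fin 4 → R} {i j : Fin 4}
  {hv : v i = 1} {hw : w j = 1} {f : Spec (.of R) ⟶ Inc}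
  (h₁ : f ≫ p₁ = P3.pt c v i hv) (h₂ : f ≫ p₂ = P3.pt c w j hw)
  {k l : Fin 4} (hk : IsUnit (v k)) (hl : IsUnit (w l))

include h₁ h₂ hk hl in
lemma le_preimage_chart_of_isUnit : ⊤ ≤ f ⁻¹ᵁ chart k l := fun p _ => by
  constructor
  · change (f ≫ p₁) p ∈ P3.chart k
    rw [h₁]
    exact P3.le_preimage_pt_of_isUnit c v i hv hk (Opens.mem_top p)
  · change (f ≫ p₂) p ∈ P3.chart l
    rw [h₂]
    exact P3.le_preimage_pt_of_isUnit c w j hw hl (Opens.mem_top p)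

lemma appLE_chartHom {v' w' : Fin 4 → R} (hv' : ∀ m, v m = v k * v' m)
    (hw' : ∀ m, w m = w l * w' m) (hvk : v' k = 1) (hwl : w' l = 1)
    (hvw : ∑ m, v' m * w' m = 0) (p : ChartRing k l) :
    f.appLE (chart k l) ⊤ (le_preimage_chart_of_isUnit h₁ h₂ hk hl) (chartHom k l p) =
      (Scheme.ΓSpecIso (.of R)).inv (ChartRing.lift c v' w' k l p) := by
  have : (f.appLE (chart k l) ⊤ (le_preimage_chart_of_isUnit h₁ h₂ hk hl)).hom.comp
      (chartHom k l) =
      (Scheme.ΓSpecIso (.of R)).inv.hom.comp (ChartRing.lift c v' w' k l) := by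
    have hle := le_preimage_chart_of_isUnit h₁ h₂ hk hl
    refine ChartRing.hom_ext (fun a => ?_) (fun m => ?_) fun m => ?_
    · rw [RingHom.comp_apply, RingHom.comp_apply, ChartRing.lift_C, chartHom_C]
      refine (appLE_comp_apply f toSpecC (le_preimage_top _ _) hle (le_preimage_top _ _) _).symm.trans
        ?_
      have e : f ≫ toSpecC = Spec.map (CommRingCat.ofHom c) := by
        rw [toSpecC, ← Category.assoc, h₁, P3.pt_toSpecC]
      refine (appLE_congr_hom e _ (le_preimage_top _ _) _).trans ?_
      refine (congrArg (fun φ : Γ(SpecC, ⊤) ⟶ Γ(Spec (.of R), ⊤) =>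
        φ.hom ((Scheme.ΓSpecIso (.of ℂ)).inv.hom a))
        (appLE_top (Spec.map (CommRingCat.ofHom c)))).trans ?_
      exact (congrArg (fun φ => φ.hom a)
        (Scheme.ΓSpecIso_inv_naturality (CommRingCat.ofHom c))).symm
    · rw [RingHom.comp_apply, RingHom.comp_apply, ChartRing.lift_y _ hvk, chartHom_y]
      refine (appLE_comp_apply f p₁ (chart_le₁ k l) hle (fun p hp => (hle hp).1) _).symm.trans ?_
      exact (appLE_congr_hom h₁ _ (P3.le_preimage_pt_of_isUnit c v i hv hk) _).trans
        (P3.pt_coord_of_mul_eq c v i hv hk hv' m)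
    · rw [RingHom.comp_apply, RingHom.comp_apply, ChartRing.lift_z _ hvk hwl hvw, chartHom_z]
      refine (appLE_comp_apply f p₂ (chart_le₂ k l) hle (fun p hp => (hle hp).2) _).symm.trans ?_
      exact (appLE_congr_hom h₂ _ (P3.le_preimage_pt_of_isUnit c w j hw hl) _).trans
        (P3.pt_coord_of_mul_eq c w j hw hl hw' m)
  exact congrArg (fun φ => φ p) this

end

open Polynomial LaurentPolynomial in
-- The left side has only positive exponents and the right side only nonpositive ones. This is why a
-- line bundle of negative degree on $\mathbb P^1$ has no sections.
lemma _root_.Polynomial.eq_zero_of_toLaurent_mul_T {R : Type*} [CommRing R] [NoZeroDivisors R]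
    {p q : R[X]} {n : ℕ} (hn : n ≠ 0)
    (h : toLaurent p * T n = LaurentPolynomial.invert (toLaurent q)) : p = 0 := by
  by_contra hp
  have : Nontrivial R := ⟨⟨_, _, fun h => hp (leadingCoeff_eq_zero.mp (h : p.leadingCoeff = 0))⟩⟩
  have h' : p * X ^ (n + q.natDegree) = q.reverse := by
    apply toLaurent_injective
    rw [toLaurent_reverse, ← h, map_mul, toLaurent_X_pow, mul_assoc, ← T_add]
    norm_cast
  have h'' := congrArg natDegree h'
  rw [natDegree_mul_X_pow _ hp] at h''
  have := q.reverse_natDegree_le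
  omega

open Polynomial LaurentPolynomial in
/-- The restriction to a line that lies in the union of two charts. -/
lemma exists_notMem_basicOpen {i j k l : Fin 4} {v w v' w' : Fin 4 → ℂ[X]}
    (hi : v i = 1) (hj : w j = 1) (hvw : ∑ m, v m * w m = 0)
    (hk : v' k = 1) (hl : w' l = 1) (hvw' : ∑ m, v' m * w' m = 0)
    (huk : IsUnit (toLaurent (v k))) (hul : IsUnit (toLaurent (w l)))
    (hv : ∀ m, toLaurent (v m) = toLaurent (v k) * LaurentPolynomial.invert (toLaurent (v' m)))
    (hw : ∀ m, toLaurent (w m) = toLaurent (w l) * LaurentPolynomial.invert (toLaurent (w' m)))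
    (hη : genericPoint Inc ∈ chart i j) (hη' : genericPoint Inc ∈ chart k l) :
    ∃ p₀ ∈ chart i j ⊓ chart k l, ∀ (r u : ChartRing i j) (s : ChartRing k l) (n : ℕ), n ≠ 0 →
      ChartRing.lift Polynomial.C v w i j u = Polynomial.X →
      toK (chart i j) hη (chartHom i j r) * toK (chart i j) hη (chartHom i j u) ^ n =
        toK (chart k l) hη' (chartHom k l s) →
      p₀ ∉ Inc.basicOpen (chartHom i j r) := by
  let φ : ℂ[X] →+* ℂ[T;T⁻¹] := toLaurent
  let ψ : ℂ[X] →+* ℂ[T;T⁻¹] := (LaurentPolynomial.invert (R := ℂ)).toRingEquiv.toRingHom.comp φ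
  have hi' : φ (v i) = 1 := by rw [hi, map_one]
  have hj' : φ (w j) = 1 := by rw [hj, map_one]
  have hφ : φ.comp Polynomial.C = LaurentPolynomial.C := by ext; simp [φ]
  have hψ : ψ.comp Polynomial.C = LaurentPolynomial.C := by ext; simp [φ, ψ]
  have hsum : ∑ m, φ (v m) * φ (w m) = 0 := by simp only [← map_mul, ← map_sum, hvw, map_zero]
  have hsum' : ∑ m, ψ (v' m) * ψ (w' m) = 0 := by simp only [← map_mul, ← map_sum, hvw', map_zero]
  -- The overlap of the two affine pieces of the line, mapped to $I$; the parameter is $T$ for the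
  -- first chart and $T^{-1}$ for the second. Any point of the image serves as $p_0$.
  obtain ⟨f, h₁, h₂⟩ := exists_pt LaurentPolynomial.C (fun m => φ (v m)) (fun m => φ (w m)) i j
    hi' hj' hsum
  have hui : IsUnit (φ (v i)) := hi' ▸ isUnit_one
  have huj : IsUnit (φ (w j)) := hj' ▸ isUnit_one
  have hle := le_preimage_chart_of_isUnit h₁ h₂ hui huj
  have hle' := le_preimage_chart_of_isUnit h₁ h₂ huk hul
  have e : ∀ r, f.appLE (chart i j) ⊤ hle (chartHom i j r) =
      (Scheme.ΓSpecIso (.of _)).inv (φ (ChartRing.lift Polynomial.C v w i j r)) := fun r => by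
    rw [ChartRing.map_lift, hφ]
    exact appLE_chartHom h₁ h₂ hui huj (fun m => by rw [hi', one_mul])
      (fun m => by rw [hj', one_mul]) hi' hj' hsum r
  have e' : ∀ s, f.appLE (chart k l) ⊤ hle' (chartHom k l s) =
      (Scheme.ΓSpecIso (.of _)).inv (ψ (ChartRing.lift Polynomial.C v' w' k l s)) := fun s => by
    rw [ChartRing.map_lift, hψ]
    exact appLE_chartHom h₁ h₂ huk hul hv hw ((congrArg ψ hk).trans (map_one ψ))
      ((congrArg ψ hl).trans (map_one ψ)) hsum' s
  have : Nonempty (Spec (.of ℂ[T;T⁻¹])) := inferInstance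
  let P := Classical.arbitrary (Spec (.of ℂ[T;T⁻¹]))
  refine ⟨f P, ⟨hle (Opens.mem_top P), hle' (Opens.mem_top P)⟩, fun r u s n hn hu h hP => ?_⟩
  have h' : resFun (V := chart i j ⊓ chart k l) inf_le_left
      (chartHom i j r * chartHom i j u ^ n) = resFun inf_le_right (chartHom k l s) := by
    have hη₂ : genericPoint Inc ∈ chart i j ⊓ chart k l := ⟨hη, hη'⟩
    apply toK_injective (chart i j ⊓ chart k l) hη₂
    rw [toK_res inf_le_left, toK_res inf_le_right, map_mul, map_pow]
    exact h
  have h'' := congrArg (f.appLE (chart i j ⊓ chart k l) ⊤ (le_preimage_inf f hle hle')) h'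
  rw [appLE_resFun, appLE_resFun, map_mul, map_pow, e, e, e', hu, ← map_pow, ← map_mul] at h''
  have h3 := (ConcreteCategory.bijective_of_isIso (Scheme.ΓSpecIso (.of ℂ[T;T⁻¹])).inv).1 h''
  -- On the line the relation becomes $r(T)T^n=s(T^{-1})$, so $r$ vanishes identically there, in
  -- particular at $p_0$.
  have h4 := Polynomial.eq_zero_of_toLaurent_mul_T hn
    (p := ChartRing.lift Polynomial.C v w i j r) (q := ChartRing.lift Polynomial.C v' w' k l s) (by
      rw [← toLaurent_X_pow, map_pow]
      exact h3)
  have h5 : P ∈ (Spec (.of ℂ[T;T⁻¹])).basicOpen (f.appLE (chart i j) ⊤ hle (chartHom i j r)) := by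
    rw [Scheme.basicOpen_appLE]
    exact ⟨Opens.mem_top P, hP⟩
  rw [e, h4, map_zero, map_zero, Scheme.basicOpen_zero] at h5
  exact h5

end Inc

/-! ### The action of automorphisms on the Picard group -/

lemma mem_basicOpen_of_mem_unitsAt {X : Scheme.{u}} [IsIntegral X] {U : X.Opens} {x : X}
    (hx : x ∈ U) {a : Γ(X, U)} {f : X.functionFieldˣ} (hf : toK U (genericPoint_mem hx) a = f)
    (h : f ∈ unitsAt x) : x ∈ X.basicOpen a := by
  obtain ⟨b, hb⟩ := (mem_unitsAt.mp h).2
  have : Nonempty U := ⟨⟨x, hx⟩⟩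
  have ha : algebraMap (X.presheaf.stalk x) X.functionField (X.presheaf.germ U x hx a) = f :=
    (Scheme.algebraMap_germ_eq_germToFunctionField X hx a).trans hf
  rw [Scheme.mem_basicOpen X a x hx]
  refine IsUnit.of_mul_eq_one b
    (IsFractionRing.injective (X.presheaf.stalk x) X.functionField ?_)
  rw [map_mul, map_one, ha, hb, ← Units.val_mul, mul_inv_cancel, Units.val_one]

/-! ### Nonnegative exponents and independence of the two hyperplane classes -/

namespace Inc

lemma xK_self (i : Fin 4) : xK i i = 1 := mul_eq_left.mp (xK_mul i i i)

lemma ξK_self (i : Fin 4) : ξK i i = 1 := mul_eq_left.mp (ξK_mul i i i)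

lemma xK_inv (i j : Fin 4) : (xK i j)⁻¹ = xK j i :=
  inv_eq_of_mul_eq_one_right ((xK_mul i j i).trans (xK_self i))

lemma ξK_inv (i j : Fin 4) : (ξK i j)⁻¹ = ξK j i :=
  inv_eq_of_mul_eq_one_right ((ξK_mul i j i).trans (ξK_self i))

lemma exists_chartHom_eq {i j : Fin 4} (hij : i ≠ j) {f : Inc.functionField}
    (hf : ∀ p ∈ chart i j, f ∈ regAt p) :
    ∃ r, toK (chart i j) (genericPoint_mem_chart hij) (chartHom i j r) = f := by
  obtain ⟨a, ha⟩ := exists_toK_of_forall (genericPoint_mem_chart hij) hf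
  obtain ⟨r, rfl⟩ := (chartHom_bijective hij).2 a
  exact ⟨r, ha⟩

/-- Here $e$ is the degree on the line. If $e=-n<0$, a section not vanishing at $p_0$ has
coordinates $r$, $s$ on the two charts with $ru^n=s$, which `H` forbids. -/
lemma nonneg_of_line {i j k l : Fin 4} (hij : i ≠ j) (hkl : k ≠ l) {a b e : ℤ}
    (h : IsGloballyGenerated (H₁ ^ a * H₂ ^ b)) {g : Inc.functionFieldˣ} {u : ChartRing i j}
    (hu : toK (chart i j) (genericPoint_mem_chart hij) (chartHom i j u) = g)
    (hg : xK i 0 ^ a * ξK j 3 ^ b = xK k 0 ^ a * ξK l 3 ^ b * g ^ e) {p₀ : Inc}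
    (hp₀ : p₀ ∈ chart i j ⊓ chart k l)
    (H : ∀ (r : ChartRing i j) (s : ChartRing k l) (n : ℕ), n ≠ 0 →
      toK (chart i j) (genericPoint_mem_chart hij) (chartHom i j r) *
          toK (chart i j) (genericPoint_mem_chart hij) (chartHom i j u) ^ n =
        toK (chart k l) (genericPoint_mem_chart hkl) (chartHom k l s) →
      p₀ ∉ Inc.basicOpen (chartHom i j r)) : 0 ≤ e := by
  by_contra! he
  obtain ⟨f, hf, hf₀⟩ := exists_mul_mem h p₀
  obtain ⟨r, hr⟩ := exists_chartHom_eq hij (hf i j)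
  obtain ⟨s, hs⟩ := exists_chartHom_eq hkl (hf k l)
  obtain ⟨n, rfl⟩ := Int.exists_eq_neg_ofNat he.le
  refine H r s n (by omega) ?_ (mem_basicOpen_of_mem_unitsAt hp₀.1 hr (hf₀ i j hp₀.1))
  rw [hr, hs, hu, hg, ← Units.val_pow_eq_pow_val, ← Units.val_mul]
  congr 1
  rw [zpow_neg, zpow_natCast, ← mul_assoc, inv_mul_cancel_right]

open Polynomial in
lemma nonneg_left {a b : ℤ} (h : IsGloballyGenerated (H₁ ^ a * H₂ ^ b)) : 0 ≤ a := by
  have h03 : (0 : Fin 4) ≠ 3 := by decide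
  have h13 : (1 : Fin 4) ≠ 3 := by decide
  have hT : LaurentPolynomial.T 1 * LaurentPolynomial.T (-1) = (1 : LaurentPolynomial ℂ) := by
    rw [← LaurentPolynomial.T_add, add_neg_cancel, LaurentPolynomial.T_zero]
  -- The points $(1:t:0:0)$ in the fixed plane $x_3=0$; the second representative $(t^{-1}:1:0:0)$
  -- is written in the inverted parameter.
  obtain ⟨p₀, hp₀, H⟩ := exists_notMem_basicOpen (i := 0) (j := 3) (k := 1) (l := 3)
    (v := ![1, X, 0, 0]) (w := ![0, 0, 0, 1]) (v' := ![X, 1, 0, 0]) (w' := ![0, 0, 0, 1])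
    rfl rfl (by simp [Fin.sum_univ_four]) rfl rfl (by simp [Fin.sum_univ_four])
    (by simpa using LaurentPolynomial.isUnit_T 1) (by simp)
    (fun m => by fin_cases m <;> simp [hT])
    (fun m => by fin_cases m <;> simp) (genericPoint_mem_chart h03) (genericPoint_mem_chart h13)
  have hu : toK (chart 0 3) (genericPoint_mem_chart h03) (chartHom 0 3 (ChartRing.y 0 3 1)) =
      xK 0 1 := by
    rw [chartHom_y, toK_x]
  refine nonneg_of_line h03 h13 (e := a) h hu ?_ hp₀ fun r s n hn => H r _ s n hn
    (ChartRing.lift_y _ rfl 1)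
  rw [xK_self, ← xK_inv 0 1, inv_zpow, one_zpow, one_mul, mul_right_comm, inv_mul_cancel, one_mul]

open Polynomial in
lemma nonneg_right {a b : ℤ} (h : IsGloballyGenerated (H₁ ^ a * H₂ ^ b)) : 0 ≤ b := by
  have h03 : (0 : Fin 4) ≠ 3 := by decide
  have h02 : (0 : Fin 4) ≠ 2 := by decide
  have hT : LaurentPolynomial.T 1 * LaurentPolynomial.T (-1) = (1 : LaurentPolynomial ℂ) := by
    rw [← LaurentPolynomial.T_add, add_neg_cancel, LaurentPolynomial.T_zero]
  -- The pencil of planes $(0:0:t:1)$ through the fixed point $(1:0:0:0)$.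
  obtain ⟨p₀, hp₀, H⟩ := exists_notMem_basicOpen (i := 0) (j := 3) (k := 0) (l := 2)
    (v := ![1, 0, 0, 0]) (w := ![0, 0, X, 1]) (v' := ![1, 0, 0, 0]) (w' := ![0, 0, 1, X])
    rfl rfl (by simp [Fin.sum_univ_four]) rfl rfl (by simp [Fin.sum_univ_four])
    (by simp) (by simpa using LaurentPolynomial.isUnit_T 1)
    (fun m => by fin_cases m <;> simp)
    (fun m => by fin_cases m <;> simp [hT])
    (genericPoint_mem_chart h03) (genericPoint_mem_chart h02)
  have hu : toK (chart 0 3) (genericPoint_mem_chart h03) (chartHom 0 3 (ChartRing.z 0 3 2)) =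
      ξK 3 2 := by
    rw [chartHom_z, toK_ξ]
  refine nonneg_of_line h03 h02 (e := b) h hu ?_ hp₀ fun r s n hn => H r _ s n hn
    (ChartRing.lift_z _ rfl rfl (by simp [Fin.sum_univ_four]) 2)
  rw [ξK_self, ← ξK_inv 3 2, inv_zpow, one_zpow, mul_one, inv_mul_cancel_right]

/-- The quotient of the two sides is the trivial class, which is globally generated, so the exponent
differences are nonnegative; exchanging the sides gives the opposite inequalities. -/
lemma zpow_mul_zpow_inj {a b a' b' : ℤ} (h : H₁ ^ a * H₂ ^ b = H₁ ^ a' * H₂ ^ b') :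
    a = a' ∧ b = b' := by
  have key : ∀ {a b a' b' : ℤ}, H₁ ^ a * H₂ ^ b = H₁ ^ a' * H₂ ^ b' → a' ≤ a ∧ b' ≤ b := by
    intro a b a' b' h
    have e : H₁ ^ (a - a') * H₂ ^ (b - b') = 1 := by
      rw [zpow_sub, zpow_sub, mul_mul_mul_comm, h, ← mul_inv, mul_inv_cancel]
    have := IsGloballyGenerated.one Inc
    rw [← e] at this
    exact ⟨sub_nonneg.mp (nonneg_left this), sub_nonneg.mp (nonneg_right this)⟩
  exact ⟨le_antisymm (key h.symm).1 (key h).1, le_antisymm (key h.symm).2 (key h).2⟩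

/-- The Picard group of the incidence variety is free with basis `H₁`, `H₂`. -/
theorem existsUnique_eq_zpow (p : Pic Inc) : ∃! n : ℤ × ℤ, p = H₁ ^ n.1 * H₂ ^ n.2 := by
  obtain ⟨a, b, rfl⟩ := exists_eq_zpow p
  refine ⟨(a, b), rfl, fun n hn => ?_⟩
  obtain ⟨h, h'⟩ := zpow_mul_zpow_inj hn
  exact Prod.ext h.symm h'.symm

end Inc

lemma Pic.pullback_id (X : Scheme.{u}) (p : Pic X) : Pic.pullback (𝟙 X) p = p := by
  obtain ⟨L, rfl⟩ := Quotient.exists_rep p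
  refine Quotient.sound (.of_eq L.U id id (fun _ => le_rfl) (fun _ => le_rfl) L.cover fun k l => ?_)
  rw [LineBundle.pullback_tr]
  ext
  simp only [pullUnit, LineBundle.tr, res, Units.coe_map, MonoidHom.coe_coe]
  rw [Scheme.Hom.appLE]
  simp
  rfl

lemma Pic.pullback_comp {X Y Z : Scheme.{u}} (f : X ⟶ Y) (g : Y ⟶ Z) (p : Pic Z) :
    Pic.pullback (f ≫ g) p = Pic.pullback f (Pic.pullback g p) := by
  obtain ⟨L, rfl⟩ := Quotient.exists_rep p
  refine Quotient.sound (.of_eq ((L.pullback g).pullback f).U id id (fun _ => le_rfl)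
    (fun _ => le_rfl) ((L.pullback g).pullback f).cover fun k l => ?_)
  rw [LineBundle.pullback_tr, LineBundle.pullback_tr]
  ext
  exact appLE_comp_apply _ _ _ _ _ _

/-- A sum of nonnegative products is zero only if each product is. The off-diagonal equations thus
force zeros, and the diagonal ones make the remaining entries $1$. -/
lemma nonneg_matrix_mul_eq_one {a b c d a' b' c' d' : ℤ} (ha : 0 ≤ a) (hb : 0 ≤ b) (hc : 0 ≤ c)
    (hd : 0 ≤ d) (ha' : 0 ≤ a') (hb' : 0 ≤ b') (hc' : 0 ≤ c') (hd' : 0 ≤ d')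
    (h₁ : a * a' + c * b' = 1) (h₂ : b * a' + d * b' = 0) (h₃ : a * c' + c * d' = 0)
    (h₄ : b * c' + d * d' = 1) : (a = 1 ∧ b = 0 ∧ c = 0 ∧ d = 1) ∨ (a = 0 ∧ b = 1 ∧ c = 1 ∧ d = 0) := by
  obtain ⟨h₂, h₂'⟩ := (add_eq_zero_iff_of_nonneg (mul_nonneg hb ha') (mul_nonneg hd hb')).mp h₂
  obtain ⟨h₃, h₃'⟩ := (add_eq_zero_iff_of_nonneg (mul_nonneg ha hc') (mul_nonneg hc hd')).mp h₃
  rcases mul_eq_zero.mp h₃ with rfl | rfl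
  · rw [zero_mul, zero_add] at h₁
    obtain ⟨rfl, rfl⟩ : c = 1 ∧ b' = 1 := by
      rcases Int.mul_eq_one_iff_eq_one_or_neg_one.mp h₁ with h | h <;> omega
    obtain rfl : d = 0 := by simpa using h₂'
    rw [zero_mul, add_zero] at h₄
    right
    rcases Int.mul_eq_one_iff_eq_one_or_neg_one.mp h₄ with h | h <;> omega
  · rw [mul_zero, zero_add] at h₄
    obtain ⟨rfl, rfl⟩ : d = 1 ∧ d' = 1 := by
      rcases Int.mul_eq_one_iff_eq_one_or_neg_one.mp h₄ with h | h <;> omega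
    obtain rfl : c = 0 := by simpa using h₃'
    rw [zero_mul, add_zero] at h₁
    obtain ⟨rfl, rfl⟩ : a = 1 ∧ a' = 1 := by
      rcases Int.mul_eq_one_iff_eq_one_or_neg_one.mp h₁ with h | h <;> omega
    left
    omega

namespace Inc

/-- An automorphism of the incidence variety acts on the Picard group trivially, or it exchanges
`H₁` and `H₂`. -/
theorem pullback_eq_id_or_swap (φ : Inc ≅ Inc) :
    Pic.pullback φ.hom = MonoidHom.id (Pic Inc) ∨
      (Pic.pullback φ.hom H₁ = H₂ ∧ Pic.pullback φ.hom H₂ = H₁) := by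
  -- Pull-back preserves global generation, so the images of $H_1$ and $H_2$ have nonnegative
  -- exponents.
  have key : ∀ f : Inc ⟶ Inc, ∃ a b c d : ℤ, 0 ≤ a ∧ 0 ≤ b ∧ 0 ≤ c ∧ 0 ≤ d ∧
      Pic.pullback f H₁ = H₁ ^ a * H₂ ^ b ∧ Pic.pullback f H₂ = H₁ ^ c * H₂ ^ d := fun f => by
    obtain ⟨a, b, h⟩ := exists_eq_zpow (Pic.pullback f H₁)
    obtain ⟨c, d, h'⟩ := exists_eq_zpow (Pic.pullback f H₂)
    have g := isGloballyGenerated_H₁.pullback f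
    have g' := isGloballyGenerated_H₂.pullback f
    rw [h] at g
    rw [h'] at g'
    exact ⟨a, b, c, d, nonneg_left g, nonneg_right g, nonneg_left g', nonneg_right g', h, h'⟩
  obtain ⟨a, b, c, d, ha, hb, hc, hd, e₁, e₂⟩ := key φ.hom
  obtain ⟨a', b', c', d', ha', hb', hc', hd', e₁', e₂'⟩ := key φ.inv
  have hcomp : ∀ p, Pic.pullback φ.hom (Pic.pullback φ.inv p) = p := fun p => by
    rw [← Pic.pullback_comp, φ.hom_inv_id, Pic.pullback_id]
  have hpow : ∀ m n : ℤ, Pic.pullback φ.hom (H₁ ^ m * H₂ ^ n) =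
      H₁ ^ (a * m + c * n) * H₂ ^ (b * m + d * n) := fun m n => by
    rw [map_mul, map_zpow, map_zpow, e₁, e₂, mul_zpow, mul_zpow, mul_mul_mul_comm, ← zpow_mul,
      ← zpow_mul, ← zpow_mul, ← zpow_mul, ← zpow_add, ← zpow_add]
  have h₁ := hcomp H₁
  rw [e₁', hpow] at h₁
  have h₂ := hcomp H₂
  rw [e₂', hpow] at h₂
  obtain ⟨i₁, i₂⟩ := zpow_mul_zpow_inj (a' := 1) (b' := 0) (h₁.trans (by simp))
  obtain ⟨i₃, i₄⟩ := zpow_mul_zpow_inj (a' := 0) (b' := 1) (h₂.trans (by simp))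
  rcases nonneg_matrix_mul_eq_one ha hb hc hd ha' hb' hc' hd' i₁ i₂ i₃ i₄ with
    ⟨rfl, rfl, rfl, rfl⟩ | ⟨rfl, rfl, rfl, rfl⟩
  · left
    ext p
    obtain ⟨m, n, rfl⟩ := exists_eq_zpow p
    rw [hpow]
    simp
  · right
    rw [e₁, e₂]
    simp

end Inc

/-! ### Automorphisms of the blow-up -/

lemma eq_of_sigmaι_eq {ι : Type u} {X : ι → Scheme.{u}} {i j : ι} {x : X i} {y : X j}
    (h : Sigma.ι X i x = Sigma.ι X j y) : i = j := by
  by_contra hij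
  exact (disjoint_opensRange_sigmaι X i j hij).le_bot ⟨⟨x, rfl⟩, ⟨y, h.symm⟩⟩

lemma exists_sigmaι_apply_eq {ι : Type u} (X : ι → Scheme.{u}) (x : (∐ X : Scheme.{u})) :
    ∃ i y, Sigma.ι X i y = x := by
  obtain ⟨⟨i, y⟩, rfl⟩ := (sigmaMk X).surjective x
  exact ⟨i, y, (sigmaMk_mk X i y).symm⟩

/-- A morphism from an irreducible scheme to a coproduct factors through one of the summands. -/
lemma exists_comp_sigmaι_eq {T : Scheme.{u}} [IrreducibleSpace T] {ι : Type u} {X : ι → Scheme.{u}}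
    (h : T ⟶ ∐ X) : ∃ (j : ι) (φ : T ⟶ X j), φ ≫ Sigma.ι X j = h := by
  obtain ⟨j, y, hy⟩ := exists_sigmaι_apply_eq X (h (genericPoint T))
  have hr : Set.range h ⊆ Set.range (Sigma.ι X j) := by
    rintro _ ⟨t, rfl⟩
    obtain ⟨k, z, hz⟩ := exists_sigmaι_apply_eq X (h t)
    -- The summand containing the image of $t$ is open, and $t$ is a specialization of the generic
    -- point, so that summand also contains the image of the generic point.
    have hη : genericPoint T ∈ h ⁻¹ᵁ (Sigma.ι X k).opensRange :=
      (genericPoint_specializes t).mem_open (h ⁻¹ᵁ (Sigma.ι X k).opensRange).2 ⟨z, hz⟩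
    obtain ⟨z', hz'⟩ := hη
    obtain rfl : k = j := eq_of_sigmaι_eq (hz'.trans hy.symm)
    exact ⟨z, hz⟩
  exact ⟨j, IsOpenImmersion.lift (Sigma.ι X j) h hr, IsOpenImmersion.lift_fac _ _ _⟩

section

variable {B : Scheme.{0}} {J : B.IdealSheafData} {ι : Type} {X : Scheme.{0}}
  [IrreducibleSpace X] [IsReduced X] (e : (∐ fun _ : ι => X) ≅ J.subscheme)

/-- An automorphism of a scheme that leaves a disjoint union of irreducible closed subschemes
invariant maps components into components. -/
lemma exists_comp_eq_comp (f : B ⟶ B)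
    (hf : f '' Set.range J.subschemeι ⊆ Set.range J.subschemeι) (i : ι) :
    ∃ (j : ι) (φ : X ⟶ X), φ ≫ Sigma.ι (fun _ : ι => X) j ≫ e.hom ≫ J.subschemeι =
      Sigma.ι (fun _ : ι => X) i ≫ e.hom ≫ J.subschemeι ≫ f := by
  -- The source is reduced, so invariance of the underlying set suffices to factor through the
  -- closed subscheme.
  obtain ⟨g, hg⟩ := exists_lift_subscheme J
    (Sigma.ι (fun _ : ι => X) i ≫ e.hom ≫ J.subschemeι ≫ f) fun x => by
      have := hf ⟨_, ⟨(Sigma.ι (fun _ : ι => X) i ≫ e.hom) x, rfl⟩, rfl⟩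
      rw [Scheme.IdealSheafData.range_subschemeι] at this
      exact this
  obtain ⟨j, φ, hφ⟩ := exists_comp_sigmaι_eq (g ≫ e.inv)
  refine ⟨j, φ, ?_⟩
  rw [← Category.assoc, hφ, Category.assoc, Iso.inv_hom_id_assoc, hg]

/-- The morphisms of components induced by $f$ and $f^{-1}$ are mutually inverse, because the
inclusions of the components are monomorphisms. -/
lemma exists_iso_comp_eq_comp (f : B ≅ B)
    (hf : f.hom '' Set.range J.subschemeι = Set.range J.subschemeι) (i : ι) :
    ∃ (j : ι) (φ : X ≅ X), φ.hom ≫ Sigma.ι (fun _ : ι => X) j ≫ e.hom ≫ J.subschemeι =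
      Sigma.ι (fun _ : ι => X) i ≫ e.hom ≫ J.subschemeι ≫ f.hom := by
  have hf' : f.inv '' Set.range J.subschemeι ⊆ Set.range J.subschemeι := by
    rintro _ ⟨_, h, rfl⟩
    rw [← hf] at h
    obtain ⟨y, hy, rfl⟩ := h
    have : f.inv (f.hom y) = y := congrArg (fun g : B ⟶ B => g y) f.hom_inv_id
    rwa [this]
  obtain ⟨j, φ, hφ⟩ := exists_comp_eq_comp e f.hom hf.le i
  obtain ⟨k, ψ, hψ⟩ := exists_comp_eq_comp e f.inv hf' j
  have h₁ : φ ≫ ψ ≫ Sigma.ι (fun _ : ι => X) k = Sigma.ι (fun _ : ι => X) i := by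
    rw [← cancel_mono (e.hom ≫ J.subschemeι), Category.assoc, Category.assoc, hψ,
      reassoc_of% hφ, Iso.hom_inv_id, Category.comp_id]
  -- Going by $f$ and back by $f^{-1}$ is the inclusion of the component $i$, and distinct summands
  -- are disjoint.
  obtain rfl : k = i := by
    have x : X := Classical.arbitrary X
    exact eq_of_sigmaι_eq (X := fun _ : ι => X) (x := (φ ≫ ψ) x) (y := x) (congrArg (fun g : X ⟶ ∐ fun _ => X => g x) h₁)
  refine ⟨j, ⟨φ, ψ, ?_, ?_⟩, hφ⟩
  · rw [← cancel_mono (Sigma.ι (fun _ : ι => X) k), Category.assoc, h₁, Category.id_comp]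
  · rw [← cancel_mono (Sigma.ι (fun _ : ι => X) j), ← cancel_mono (e.hom ≫ J.subschemeι),
      Category.assoc, Category.assoc, Category.assoc, hφ, reassoc_of% hψ, Iso.inv_hom_id,
      Category.comp_id, Category.id_comp]

end



end

end IncidenceBlowup

theorem mainTheorem10 {Y B : Scheme.{0}} (s : Y ⟶ IncidenceBlowup.SpecC)
    (J : Y.IdealSheafData) (π : B ⟶ Y) (hπ : IncidenceBlowup.IsBlowup J π)
    {ι : Type} (e : (∐ fun _ : ι => IncidenceBlowup.Inc) ≅ IncidenceBlowup.excDiv J π)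
    (he : ∀ i : ι,
      Sigma.ι (fun _ : ι => IncidenceBlowup.Inc) i ≫ e.hom ≫ IncidenceBlowup.excIncl J π ≫ π ≫ s =
        IncidenceBlowup.Inc.toSpecC)
    (f : B ≅ B) (hf : f.hom ≫ π ≫ s = π ≫ s)
    (hE : f.hom '' Set.range (IncidenceBlowup.excIncl J π) =
      Set.range (IncidenceBlowup.excIncl J π)) :
    (∀ L : IncidenceBlowup.Pic IncidenceBlowup.Inc,
      ∃! n : ℤ × ℤ, L = IncidenceBlowup.H₁ ^ n.1 * IncidenceBlowup.H₂ ^ n.2) ∧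
    ∀ i : ι, ∃ (j : ι) (φ : IncidenceBlowup.Inc ≅ IncidenceBlowup.Inc),
      φ.hom ≫ IncidenceBlowup.Inc.toSpecC = IncidenceBlowup.Inc.toSpecC ∧
      (Sigma.ι (fun _ : ι => IncidenceBlowup.Inc) i ≫ e.hom ≫ IncidenceBlowup.excIncl J π) ≫ f.hom =
        φ.hom ≫ Sigma.ι (fun _ : ι => IncidenceBlowup.Inc) j ≫ e.hom ≫
          IncidenceBlowup.excIncl J π ∧
      (IncidenceBlowup.Pic.pullback φ.hom = MonoidHom.id (IncidenceBlowup.Pic IncidenceBlowup.Inc) ∨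
        (IncidenceBlowup.Pic.pullback φ.hom IncidenceBlowup.H₁ = IncidenceBlowup.H₂ ∧
          IncidenceBlowup.Pic.pullback φ.hom IncidenceBlowup.H₂ = IncidenceBlowup.H₁)) := by
  refine ⟨IncidenceBlowup.Inc.existsUnique_eq_zpow, fun i => ?_⟩
  obtain ⟨j, φ, h⟩ := IncidenceBlowup.exists_iso_comp_eq_comp e f hE i
  refine ⟨j, φ, ?_, ?_, IncidenceBlowup.Inc.pullback_eq_id_or_swap φ⟩
  -- Composing with the structure morphism of the blow-up: $f$ and the identifications of the
  -- components are over $\mathbb C$, hence so is `φ`.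
  · have h' := congrArg (· ≫ π ≫ s) h
    simp only [Category.assoc] at h'
    rw [hf] at h'
    exact (congrArg (φ.hom ≫ ·) (he j)).symm.trans (h'.trans (he i))
  · rw [Category.assoc, Category.assoc]
    exact h.symm
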